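/- **Setting.** A single-hop radio network has $n$ nodes and $\mathcal F\ge 1$ channels, numbered $1,\dots,\mathcal F$, channel $1$ being the *primary* channel. Time is divided into rounds $t=0,1,2,\dots$ of four slots each. In a slot a node uses at most one channel, to transmit or to listen. A listener on a channel receives the message if exactly one node transmits on that channel, perceives silence if none does, and perceives a collision if at least two do (collision detection). Initially the nodes of a set $K$ of $k$ source nodes, $1\le k\le n$, hold one packet each. **The uniform information exchange (UIE) protocol** with parameter $0<\zeta<1$. Nodes know neither $n$ nor $k$. Source nodes start *active*, all others *inactive*; every active node $v$ has two probabilities $p(v),q(v)$, both initially $\zeta$, and every node $v$ stores the set $m(v)$ of packets it knows (its own packet, or $\emptyset$, at the start). All random choices are independent. * *Slot 1.* Every active $v$ picks a uniformly random channel and on it transmits $m(v)$ with probability $p(v)$, otherwise listens; packets in a received message are added to $m(v)$ at once. If $v$ listened and heard silence, $p(v)\leftarrow\min\{\zeta,2p(v)\}$; otherwise $p(v)\leftarrow p(v)/2$. Inactive nodes do nothing. * *Slot 2.* Every active node that received a message in slot 1 transmits an acknowledgement on its channel; the other active nodes listen on theirs. A node that transmitted in slot 1 and now detects a transmission (a message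 or a collision) becomes inactive immediately. * *Slot 3.* Every active $v$ transmits $m(v)$ on the primary channel with probability $q(v)$; all other nodes listen to it, and every receiver adds the received packets to its set. Active nodes update $q(v)$ by the same rule as $p(v)$ in slot 1. * *Slot 4.* Every node that received a message in slot 3 transmits an acknowledgement on the primary channel. A node that transmitted in slot 3 and now detects a transmission becomes inactive. **Theorem.** There is a constant $\zeta_0\in(0,1)$ such that for every $0<\zeta\le\zeta_0$ there are constants $\nu>0$ and $c>0$ (depending only on $\zeta$) such that for all $n$, all $\mathcal F\ge1$ and all sets $K$ of $k$ source nodes with $1\le k\le n$ the following holds with $T^*:=\nu\,(k/\mathcal F+\mathcal F\log n)$, where $\log$ is the natural logarithm. 1. With probability at least $1-n^{-c}$, there is a moment not later than time $T^*$ (after slot 2 or slot 4 of some round, or at the start) at which exactly one node is active. 2. With probability at least $1-n^{-c}$, there is such a moment not later than $T^*$ with exactly one active node $v$, and moreover by time $T^{**}:=2T^*+\log n$ (after $\lfloor T^{**}\rfloor$ rounds) node $v$ is inactive and every node of the network knows all $k$ packets. -/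

import Mathlib

open scoped NNReal ENNReal

noncomputable section

namespace UIE

/-! ## The network: single-hop, `F` channels, collision detection -/

/-- What a node does in one slot: stay off, listen to a channel, or transmit on a channel.
A message is a set of packets, and the packet of a source node is named by that node. -/
inductive Action (n F : ℕ) where
  | off : Action n F
  | listen (c : Fin F) : Action n F
  | transmit (c : Fin F) (m : Finset (Fin n)) : Action n F

/-- What a node perceives in one slot. A node that does not listen perceives `nothing`. -/
inductive Observation (n : ℕ) where
  | nothing : Observation n
  | silence : Observation n
  | message (m : Finset (Fin n)) : Observation n
  | collision : Observation n

/-- The action is a transmission on channel `c`. -/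
def Action.TransmitsOn {n F : ℕ} : Action n F → Fin F → Prop
  | .transmit d _, c => d = c
  | _, _ => False

/-- The action is a transmission. -/
def Action.Transmits {n F : ℕ} : Action n F → Prop
  | .transmit _ _ => True
  | _ => False

/-- The packets in the transmitted message. -/
def Action.payload {n F : ℕ} : Action n F → Finset (Fin n)
  | .transmit _ m => m
  | _ => ∅

/-- The listener received a message. -/
def Observation.IsMessage {n : ℕ} : Observation n → Prop
  | .message _ => True
  | _ => False

/-- The listener detected a transmission: it received a message or noticed a collision. -/
def Observation.Busy {n : ℕ} : Observation n → Prop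
  | .message _ => True
  | .collision => True
  | _ => False

/-- The packets received with an observation. -/
def Observation.packets {n : ℕ} : Observation n → Finset (Fin n)
  | .message m => m
  | _ => ∅

open Classical in
/-- The nodes that transmit on channel `c`. -/
def transmitters {n F : ℕ} (a : Fin n → Action n F) (c : Fin F) : Finset (Fin n) :=
  Finset.univ.filter fun u => (a u).TransmitsOn c

/-- The outcome of a slot for node `v`: a listener gets the message if there is exactly one
transmitter on its channel, and tells silence from collision otherwise. -/
def observe {n F : ℕ} (a : Fin n → Action n F) (v : Fin n) : Observation n :=
  match a v with
  | .listen c =>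
    if (transmitters a c).card = 0 then .silence
    else if (transmitters a c).card = 1 then
      .message ((transmitters a c).biUnion fun u => (a u).payload)
    else .collision
  | _ => .nothing

open Classical in
/-- The acknowledgement slot that follows a slot with actions `a`: whoever received a message
transmits an acknowledgement (a message without packets) on the same channel, everybody else
that used a channel listens to it. -/
def ackActions {n F : ℕ} (a : Fin n → Action n F) (v : Fin n) : Action n F :=
  match a v with
  | .off => .off
  | .listen c => if (observe a v).IsMessage then .transmit c ∅ else .listen c
  | .transmit c _ => .listen c

/-- Node `v` transmitted in the first of two slots and detects transmissions (the
acknowledgements) in the second. -/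
def Acknowledged {n F : ℕ} (a : Fin n → Action n F) (v : Fin n) : Prop :=
  (a v).Transmits ∧ (observe (ackActions a) v).Busy

/-! ## The protocol -/

/-- A configuration: the active nodes, the packets `m(v)` known to each node, and the transmission
probabilities `p(v)` (multi-channel process) and `q(v)` (primary-channel process). -/
structure Config (n : ℕ) where
  active : Finset (Fin n)
  known : Fin n → Finset (Fin n)
  p : Fin n → ℝ≥0
  q : Fin n → ℝ≥0

open Classical in
/-- The initial configuration with source nodes `K`. -/
def init {n : ℕ} (ζ : ℝ≥0) (K : Finset (Fin n)) : Config n where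
  active := K
  known v := if v ∈ K then {v} else ∅
  p _ := ζ
  q _ := ζ

/-- The update of a transmission probability `w` after an observation: double it (up to `ζ`) if
the node listened and its channel was idle, halve it otherwise. -/
def newProb {n : ℕ} (ζ w : ℝ≥0) : Observation n → ℝ≥0
  | .silence => min ζ (2 * w)
  | _ => w / 2

open Classical in
/-- First slot, multi-channel process: an active node transmits all its packets on, or listens to,
its selected channel; inactive nodes do nothing. `r v` is the channel selected by `v` together
with the outcome of its transmission coin. -/
def multiActions {n F : ℕ} (x : Config n) (r : Fin n → Fin F × Bool) (v : Fin n) : Action n F :=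
  if v ∈ x.active then
    if (r v).2 then .transmit (r v).1 (x.known v) else .listen (r v).1
  else .off

open Classical in
/-- First slot, primary-channel process: an active node transmits on the primary channel
(channel `0`) according to its coin `b v`; all other nodes listen to the primary channel. -/
def primaryActions {n F : ℕ} [NeZero F] (x : Config n) (b : Fin n → Bool) (v : Fin n) :
    Action n F :=
  if v ∈ x.active ∧ b v then .transmit 0 (x.known v) else .listen 0

open Classical in
/-- The configuration after slots 1 and 2. -/
def afterMulti {n F : ℕ} (ζ : ℝ≥0) (x : Config n) (r : Fin n → Fin F × Bool) : Config n :=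
  let a := multiActions x r
  { active := x.active.filter fun v => ¬ Acknowledged a v
    known := fun v => x.known v ∪ (observe a v).packets
    p := fun v => if v ∈ x.active then newProb ζ (x.p v) (observe a v) else x.p v
    q := x.q }

open Classical in
/-- The configuration after slots 3 and 4. -/
def afterPrimary {n : ℕ} (F : ℕ) [NeZero F] (ζ : ℝ≥0) (x : Config n) (b : Fin n → Bool) :
    Config n :=
  let a : Fin n → Action n F := primaryActions x b
  { active := x.active.filter fun v => ¬ Acknowledged a v
    known := fun v => x.known v ∪ (observe a v).packets
    p := x.p
    q := fun v => if v ∈ x.active then newProb ζ (x.q v) (observe a v) else x.q v }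

/-! ## Randomness -/

/-- A coin that shows `true` with probability `w` (with probability `1` if `w > 1`, which never
happens in the protocol when `ζ ≤ 1`). -/
def coin (w : ℝ≥0) : PMF Bool :=
  PMF.ofFintype (fun b => if b then ((min w 1 : ℝ≥0) : ℝ≥0∞) else 1 - ((min w 1 : ℝ≥0) : ℝ≥0∞)) (by
    have h : ((min w 1 : ℝ≥0) : ℝ≥0∞) ≤ 1 := by exact_mod_cast min_le_right w 1
    simp [add_tsub_cancel_of_le h])

/-- Independent draws, one for each index. -/
def indep {ι α : Type*} [Fintype ι] [DecidableEq ι] [Fintype α] (μ : ι → PMF α) : PMF (ι → α) :=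
  PMF.ofFintype (fun a => ∏ i, μ i (a i)) (by
    rw [← Fintype.piFinset_univ, ← Finset.prod_univ_sum]
    refine Finset.prod_eq_one fun i _ => ?_
    rw [← tsum_fintype (L := SummationFilter.unconditional α)]
    exact (μ i).tsum_coe)

/-- The random choice of one node in slot 1: a uniform channel and, independently, a coin. -/
def channelAndCoin (F : ℕ) [NeZero F] (w : ℝ≥0) : PMF (Fin F × Bool) :=
  (PMF.uniformOfFintype (Fin F)).bind fun c => (coin w).map fun b => (c, b)

/-- Slots 1 and 2 as a random transition. -/
def multiStep {n : ℕ} (F : ℕ) [NeZero F] (ζ : ℝ≥0) (x : Config n) : PMF (Config n) :=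
  (indep fun v => channelAndCoin F (x.p v)).map (afterMulti ζ x)

/-- Slots 3 and 4 as a random transition. -/
def primaryStep {n : ℕ} (F : ℕ) [NeZero F] (ζ : ℝ≥0) (x : Config n) : PMF (Config n) :=
  (indep fun v => coin (x.q v)).map (afterPrimary F ζ x)

/-- Half of a round: the `h`-th half-round is slots 1 and 2 of round `h / 2` if `h` is even, and
slots 3 and 4 of round `h / 2` if `h` is odd. -/
def halfRound {n : ℕ} (F : ℕ) [NeZero F] (ζ : ℝ≥0) (h : ℕ) : Config n → PMF (Config n) :=
  if Even h then multiStep F ζ else primaryStep F ζ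

/-- The law of the execution during its first `H` half-rounds: `x h` is the configuration after
`h` half-rounds, for `h ≤ H`; in particular `x (2 * t)` is the configuration at time `t`, that is,
when `t` rounds are over. (Entries beyond `H` have no meaning.) -/
def execution {n : ℕ} (F : ℕ) [NeZero F] (ζ : ℝ≥0) (K : Finset (Fin n)) :
    ℕ → PMF (ℕ → Config n)
  | 0 => PMF.pure fun _ => init ζ K
  | H + 1 => (execution F ζ K H).bind fun x =>
      (halfRound F ζ H (x H)).map fun y => Function.update x (H + 1) y

/-- The probability of an event under a discrete law. -/
def prob {α : Type*} (μ : PMF α) (S : Set α) : ℝ := (μ.toOuterMeasure S).toReal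

/-- The time `T* = ν (k / F + F log n)`. -/
def tStar (ν : ℝ) (n F k : ℕ) : ℝ := ν * ((k : ℝ) / F + F * Real.log n)

/-- The last whole round that is over by the (real) time `2 T* + log n`. -/
def lastRound (ν : ℝ) (n F k : ℕ) : ℕ := ⌊2 * tStar ν n F k + Real.log n⌋₊

/-- `v` is the only active node at some moment (after a whole number of half-rounds) of the
execution `x` not later than time `T`. -/
def SoleActiveBy {n : ℕ} (x : ℕ → Config n) (T : ℝ) (v : Fin n) : Prop :=
  ∃ h : ℕ, (h : ℝ) / 2 ≤ T ∧ (x h).active = {v}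

end UIE

end

open scoped NNReal ENNReal

namespace UIE

/-! ## A potential for contention resolution -/

section

/-! Both claims follow from one event: nobody is active after `s + t` rounds, where `s + t ≤ T*`. A
half-round with at least two active nodes leaves somebody active, so an execution that runs empty
has passed through a moment with exactly one active node. A node that drops out hands its packets to
an active listener or, on the primary channel, to everybody; hence nothing is lost, and once nobody
is active everybody knows everything (`exists_sole_of_path`).

The speed comes from a single potential for `m` competitors with probabilities `w` on `F` channels,
namely `exp (2m/F) * ((1+Y)^4 * S)^β` with contention `Y = (∑ w)/F` and `S = F * (∑ w⁻¹)/m²`. If `Y`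
is large, silence is rare and `Y` shrinks; if `Y` is small, silence is common and `S` shrinks; in
between, a constant fraction of the channels loses a competitor on average and `m/F` falls. The
exponent `β` is small enough for the drop in `m/F` to pay for the growth of `Y` and `S` in that last
regime, so the potential contracts in the mean by a constant factor (`sum_exp_mul_rpow_le`,
`sum_potential_le`). By Cauchy–Schwarz it is at least `1` while more than `M` nodes compete, so its
mean bounds the probability of that event.

The potential is used twice: on all channels with `M = 10F`, and on the primary channel alone with
`F = 1`, `M = 0`. Each process acts on the other only by removing nodes, which never raises a
potential (`potential_mono`). The first starts below `exp (6k/F)/ζ` and needs `s` rounds. By then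
`q` may have shrunk to `ζ/2^(2s)`, so the second starts below `exp (60F) * 2^(2s)/ζ` and needs `t`
further rounds (`mean_active_le`, `exists_phases`). -/

/-- Jensen's inequality for the concave power function, for finite averages. -/
lemma sum_mul_rpow_le {Ω : Type*} [Fintype Ω] {w f : Ω → ℝ} {γ : ℝ} (hw : ∀ ω, 0 ≤ w ω)
    (hw1 : ∑ ω, w ω = 1) (hf : ∀ ω, 0 ≤ f ω) (h0 : 0 ≤ γ) (h1 : γ ≤ 1) :
    ∑ ω, w ω * f ω ^ γ ≤ (∑ ω, w ω * f ω) ^ γ := by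
  simpa using (Real.concaveOn_rpow h0 h1).le_map_sum (t := Finset.univ) (w := w) (p := f)
    (fun i _ => hw i) hw1 (fun i _ => hf i)

/-- A random update of `(Y, S)` that contracts `Y` when `Y` is large, contracts `S` when `Y` is
small, and makes progress `D` otherwise contracts `exp (-D) * ((1 + Y) ^ 4 * S) ^ β` in the mean. -/
lemma sum_exp_mul_rpow_le {Ω : Type*} [Fintype Ω] {w Y' S' D : Ω → ℝ} {Y S a s : ℝ}
    (hw : ∀ ω, 0 ≤ w ω) (hw1 : ∑ ω, w ω = 1) (hY : 0 < Y) (hS : 0 < S)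
    (hY0 : ∀ ω, 0 ≤ Y' ω) (hY2 : ∀ ω, Y' ω ≤ 2 * Y) (hS0 : ∀ ω, 0 ≤ S' ω)
    (hS2 : ∀ ω, S' ω ≤ 2 * S) (hD0 : ∀ ω, 0 ≤ D ω) (hD1 : ∀ ω, D ω ≤ 1)
    (ha : a ≤ 1 / 100) (hs : 0 < s) (hs1 : s ≤ 1)
    (high : 4 ≤ Y → ∑ ω, w ω * Y' ω ≤ 11 / 20 * Y)
    (low : Y ≤ a → ∑ ω, w ω * S' ω ≤ 3 / 5 * S)
    (mid : a ≤ Y → Y ≤ 4 → s ≤ ∑ ω, w ω * D ω) :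
    ∑ ω, w ω * (Real.exp (-D ω) * ((1 + Y' ω) ^ 4 * S' ω) ^ (s / 16)) ≤
      Real.exp (-(s / 64)) * ((1 + Y) ^ 4 * S) ^ (s / 16) := by
  have hβ : 0 < s / 16 := by positivity
  have hexp : ∀ ω, Real.exp (-D ω) ≤ 1 := fun ω => Real.exp_le_one_iff.2 (by linarith [hD0 ω])
  -- For large and for small `Y` it is enough to shrink the base by the factor `7/10`.
  have hseven : (7 / 10 : ℝ) ^ (s / 16) ≤ Real.exp (-(s / 64)) := by
    have h : (7 / 10 : ℝ) ≤ Real.exp (-(1 / 4)) := by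
      have := Real.add_one_le_exp (-(1 / 4) : ℝ)
      linarith
    calc (7 / 10 : ℝ) ^ (s / 16) ≤ Real.exp (-(1 / 4)) ^ (s / 16) := by gcongr
      _ = Real.exp (-(s / 64)) := by rw [← Real.exp_mul]; congr 1; ring
  have key : ∀ {c : ℝ}, 0 ≤ c → c ≤ 7 / 10 → (c * ((1 + Y) ^ 4 * S)) ^ (s / 16) ≤
      Real.exp (-(s / 64)) * ((1 + Y) ^ 4 * S) ^ (s / 16) := by
    intro c hc0 hc
    rw [Real.mul_rpow hc0 (by positivity)]
    gcongr
    exact le_trans (by gcongr) hseven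
  -- Large `Y`: `1 + (11/20) Y ≤ (16/25) (1 + Y)` from `Y = 4` on, and the fourth power outweighs a
  -- possible doubling of `S`, since `2 * (16/25)^4 < 7/10`.
  by_cases hh : 4 ≤ Y
  · have h4 : ∑ ω, w ω * (1 + Y' ω) ^ (4 * (s / 16)) ≤ (16 / 25 * (1 + Y)) ^ (4 * (s / 16)) := by
      refine (sum_mul_rpow_le hw hw1 (fun ω => by linarith [hY0 ω]) (by positivity)
        (by linarith)).trans ?_
      refine Real.rpow_le_rpow (Finset.sum_nonneg fun ω _ =>
        mul_nonneg (hw ω) (by linarith [hY0 ω])) ?_ (by positivity)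
      simp only [mul_add, mul_one, Finset.sum_add_distrib, hw1]
      linarith [high hh]
    have e4 : ∀ z : ℝ, 0 ≤ z → z ^ (4 * (s / 16)) = (z ^ 4) ^ (s / 16) := fun z hz => by
      rw [Real.rpow_mul hz]; norm_cast
    calc _ ≤ ∑ ω, (w ω * (1 + Y' ω) ^ (4 * (s / 16))) * (2 * S) ^ (s / 16) := by
            refine Finset.sum_le_sum fun ω _ => ?_
            have h1 := hY0 ω
            have h2 := hS0 ω
            rw [mul_assoc, e4 _ (by linarith), Real.mul_rpow (by positivity) h2]
            refine mul_le_mul_of_nonneg_left ?_ (hw ω)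
            refine (mul_le_of_le_one_left (by positivity) (hexp ω)).trans ?_
            gcongr
            exact hS2 ω
      _ ≤ (16 / 25 * (1 + Y)) ^ (4 * (s / 16)) * (2 * S) ^ (s / 16) := by
            rw [← Finset.sum_mul]; gcongr
      _ = ((2 * (16 / 25) ^ 4) * ((1 + Y) ^ 4 * S)) ^ (s / 16) := by
            rw [e4 _ (by positivity), ← Real.mul_rpow (by positivity) (by positivity)]
            congr 1; ring
      _ ≤ _ := key (by norm_num) (by norm_num)
  -- Small `Y`: the factor `3/5` gained on `S` survives the growth of `(1 + Y)^4` by at most `(1 +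
  -- 1/50)^4`.
  by_cases hl : Y ≤ a
  · calc _ ≤ ∑ ω, (w ω * S' ω ^ (s / 16)) * ((1 + 2 * Y) ^ 4) ^ (s / 16) := by
            refine Finset.sum_le_sum fun ω _ => ?_
            have h1 := hY0 ω
            have h2 := hS0 ω
            rw [mul_assoc, Real.mul_rpow (by positivity) h2, mul_comm (S' ω ^ _)]
            refine mul_le_mul_of_nonneg_left ?_ (hw ω)
            refine (mul_le_of_le_one_left (by positivity) (hexp ω)).trans ?_
            gcongr
            exact hY2 ω
      _ ≤ (3 / 5 * S) ^ (s / 16) * ((1 + 1 / 50) ^ 4) ^ (s / 16) := by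
            rw [← Finset.sum_mul]
            have h1 : ∑ ω, w ω * S' ω ^ (s / 16) ≤ (3 / 5 * S) ^ (s / 16) :=
              (sum_mul_rpow_le hw hw1 hS0 hβ.le (by linarith)).trans
                (Real.rpow_le_rpow (Finset.sum_nonneg fun ω _ => mul_nonneg (hw ω) (hS0 ω))
                  (low hl) hβ.le)
            gcongr
            linarith
      _ = ((3 / 5 * (1 + 1 / 50) ^ 4) * S) ^ (s / 16) := by
            rw [← Real.mul_rpow (by positivity) (by positivity)]
            congr 1; ring
      _ ≤ ((3 / 5 * (1 + 1 / 50) ^ 4) * ((1 + Y) ^ 4 * S)) ^ (s / 16) := by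
            gcongr
            exact le_mul_of_one_le_left hS.le (one_le_pow₀ (by linarith))
      _ ≤ _ := key (by norm_num) (by norm_num)
  -- Moderate `Y`: the base grows by at most `2^4 * 2 = 32`, which costs `exp (s/4)` after taking
  -- the power; the progress `D` gains `exp (-s/2)`.
  · have hm := mid (by linarith) (by linarith)
    have e32 : (32 : ℝ) ^ (s / 16) ≤ Real.exp (s / 4) := by
      have h : (32 : ℝ) ≤ Real.exp 4 := by
        have := Real.exp_one_gt_d9
        calc (32 : ℝ) ≤ 2.7182818283 ^ 4 := by norm_num
          _ ≤ Real.exp 1 ^ 4 := by gcongr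
          _ = Real.exp 4 := by rw [← Real.exp_nat_mul]; norm_num
      calc (32 : ℝ) ^ (s / 16) ≤ Real.exp 4 ^ (s / 16) := by gcongr
        _ = Real.exp (s / 4) := by rw [← Real.exp_mul]; congr 1; ring
    have hconv : ∀ ω, Real.exp (-D ω) ≤ 1 - D ω / 2 := fun ω => by
      have h0 := hD0 ω
      have h1 := hD1 ω
      have := Real.add_one_le_exp (D ω)
      rw [Real.exp_neg, inv_le_iff_one_le_mul₀ (Real.exp_pos _)]
      nlinarith
    have hsum : ∑ ω, w ω * Real.exp (-D ω) ≤ Real.exp (-(s / 2)) := by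
      calc _ ≤ ∑ ω, (w ω - w ω * D ω / 2) := Finset.sum_le_sum fun ω _ => by
              nlinarith [hw ω, hconv ω, mul_le_mul_of_nonneg_left (hconv ω) (hw ω)]
        _ ≤ 1 - s / 2 := by
              rw [Finset.sum_sub_distrib, hw1, ← Finset.sum_div]; linarith
        _ ≤ _ := by linarith [Real.add_one_le_exp (-(s / 2))]
    calc _ ≤ ∑ ω, (w ω * Real.exp (-D ω)) * (32 * ((1 + Y) ^ 4 * S)) ^ (s / 16) := by
            refine Finset.sum_le_sum fun ω _ => ?_
            have h1 := hY0 ω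
            have h2 := hS0 ω
            rw [mul_assoc]
            refine mul_le_mul_of_nonneg_left (mul_le_mul_of_nonneg_left
              (Real.rpow_le_rpow (by positivity) ?_ hβ.le) (Real.exp_pos _).le) (hw ω)
            calc (1 + Y' ω) ^ 4 * S' ω ≤ (2 * (1 + Y)) ^ 4 * (2 * S) := by
                  gcongr
                  · linarith [hY2 ω]
                  · exact hS2 ω
              _ = _ := by ring
      _ ≤ Real.exp (-(s / 2)) * (Real.exp (s / 4) * ((1 + Y) ^ 4 * S) ^ (s / 16)) := by
            rw [← Finset.sum_mul, Real.mul_rpow (by norm_num) (by positivity)]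
            gcongr
      _ ≤ _ := by
            rw [← mul_assoc, ← Real.exp_add]
            gcongr
            linarith

/-- The potential of a set `A` of competing nodes with transmission probabilities `w` on `F`
channels; it vanishes when at most `M` nodes are left. -/
noncomputable def potential {ι : Type*} (F : ℝ) (M : ℕ) (β : ℝ) (A : Finset ι) (w : ι → ℝ) : ℝ :=
  if A.card ≤ M then 0 else
    Real.exp (2 * A.card / F) *
      ((1 + (∑ v ∈ A, w v) / F) ^ 4 * (F * (∑ v ∈ A, (w v)⁻¹) / (A.card : ℝ) ^ 2)) ^ β

variable {ι : Type*} {F β : ℝ} {M : ℕ} {A A' : Finset ι} {w : ι → ℝ}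

lemma potential_nonneg (hF : 0 < F) (hw : ∀ v ∈ A, 0 ≤ w v) : 0 ≤ potential F M β A w := by
  unfold potential
  split_ifs with h
  · exact le_rfl
  · have h1 : 0 ≤ ∑ v ∈ A, w v := Finset.sum_nonneg hw
    have h2 : 0 ≤ ∑ v ∈ A, (w v)⁻¹ := Finset.sum_nonneg fun v hv => inv_nonneg.2 (hw v hv)
    positivity

/-- Removing nodes decreases the potential. -/
lemma potential_le_of_subset (hF : 0 < F) (hM : F ≤ M + 1) (hβ : 0 ≤ β) (hβ1 : β ≤ 1 / 2)
    (hA : A' ⊆ A) (hw : ∀ v ∈ A, 0 ≤ w v) :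
    potential F M β A' w ≤ Real.exp (2 * A.card / F) *
      (Real.exp (-((A.card - A'.card : ℝ) / F)) *
        ((1 + (∑ v ∈ A, w v) / F) ^ 4 * (F * (∑ v ∈ A, (w v)⁻¹) / (A.card : ℝ) ^ 2)) ^ β) := by
  have hi : ∀ v ∈ A, 0 ≤ (w v)⁻¹ := fun v hv => inv_nonneg.2 (hw v hv)
  have h1 : 0 ≤ ∑ v ∈ A, w v := Finset.sum_nonneg hw
  have h2 : 0 ≤ ∑ v ∈ A, (w v)⁻¹ := Finset.sum_nonneg hi
  unfold potential
  split_ifs with h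
  · positivity
  · have hm' : F ≤ A'.card := hM.trans (by exact_mod_cast not_le.1 h)
    have hm0 : (0 : ℝ) < A'.card := hF.trans_le hm'
    have hmm : (A'.card : ℝ) ≤ A.card := by exact_mod_cast Finset.card_le_card hA
    have hm : (0 : ℝ) < A.card := hm0.trans_le hmm
    have h1' : 0 ≤ ∑ v ∈ A', w v := Finset.sum_nonneg fun v hv => hw v (hA hv)
    have h2' : 0 ≤ ∑ v ∈ A', (w v)⁻¹ := Finset.sum_nonneg fun v hv => hi v (hA hv)
    set d : ℝ := (A.card - A'.card : ℝ) / F with hd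
    have hd0 : 0 ≤ d := div_nonneg (by linarith) hF.le
    -- At least `F` nodes survive here, so the ratio of the counts is at most `1 + d`. Its square to
    -- the power `β ≤ 1/2` then uses up only `exp d` of the gain `exp (2d)` from the leading factor;
    -- the other `exp d` is kept as progress.
    have hratio : (A.card : ℝ) / A'.card ≤ Real.exp d := by
      have : (A.card : ℝ) / A'.card ≤ d + 1 := by
        rw [div_le_iff₀ hm0, hd]
        have : (A.card - A'.card : ℝ) ≤ (A.card - A'.card : ℝ) / F * A'.card := by
          rw [div_mul_eq_mul_div, le_div_iff₀ hF]
          exact mul_le_mul_of_nonneg_left hm' (by linarith)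
        linarith
      linarith [Real.add_one_le_exp d]
    have hsq : (Real.exp d ^ 2) ^ β ≤ Real.exp d := by
      rw [← Real.exp_nat_mul, ← Real.exp_mul]
      apply Real.exp_le_exp.2
      push_cast
      nlinarith
    have hbase : (1 + (∑ v ∈ A', w v) / F) ^ 4 * (F * (∑ v ∈ A', (w v)⁻¹) / (A'.card : ℝ) ^ 2) ≤
        Real.exp d ^ 2 * ((1 + (∑ v ∈ A, w v) / F) ^ 4 *
          (F * (∑ v ∈ A, (w v)⁻¹) / (A.card : ℝ) ^ 2)) := by
      calc _ ≤ (1 + (∑ v ∈ A, w v) / F) ^ 4 * (F * (∑ v ∈ A, (w v)⁻¹) / (A'.card : ℝ) ^ 2) := by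
            have e1 := Finset.sum_le_sum_of_subset_of_nonneg hA fun v hv _ => hw v hv
            have e2 := Finset.sum_le_sum_of_subset_of_nonneg hA fun v hv _ => hi v hv
            gcongr
        _ = ((A.card : ℝ) / A'.card) ^ 2 * ((1 + (∑ v ∈ A, w v) / F) ^ 4 *
          (F * (∑ v ∈ A, (w v)⁻¹) / (A.card : ℝ) ^ 2)) := by
            field_simp
        _ ≤ _ := by gcongr
    calc _ ≤ Real.exp (2 * A'.card / F) * (Real.exp d * ((1 + (∑ v ∈ A, w v) / F) ^ 4 *
          (F * (∑ v ∈ A, (w v)⁻¹) / (A.card : ℝ) ^ 2)) ^ β) := by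
            gcongr
            refine (Real.rpow_le_rpow (by positivity) hbase hβ).trans ?_
            rw [Real.mul_rpow (by positivity) (by positivity)]
            gcongr
      _ = _ := by
            rw [← mul_assoc, ← mul_assoc, ← Real.exp_add, ← Real.exp_add]
            congr 2
            rw [hd]
            field_simp
            ring

/-- This decouples the two processes: a half-round of one leaves the probabilities of the other
alone and only removes nodes. -/
lemma potential_mono (hF : 0 < F) (hM : F ≤ M + 1) (hβ : 0 ≤ β) (hβ1 : β ≤ 1 / 2)
    (hA : A' ⊆ A) (hw : ∀ v ∈ A, 0 ≤ w v) :
    potential F M β A' w ≤ potential F M β A w := by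
  have hmm : (A'.card : ℝ) ≤ A.card := by exact_mod_cast Finset.card_le_card hA
  by_cases h : A'.card ≤ M
  · rw [potential, if_pos h]
    exact potential_nonneg hF hw
  refine (potential_le_of_subset hF hM hβ hβ1 hA hw).trans ?_
  rw [potential, if_neg (by have := Finset.card_le_card hA; omega)]
  have h1 : 0 ≤ ∑ v ∈ A, w v := Finset.sum_nonneg hw
  have h2 : 0 ≤ ∑ v ∈ A, (w v)⁻¹ := Finset.sum_nonneg fun v hv => inv_nonneg.2 (hw v hv)
  gcongr
  refine mul_le_of_le_one_left (by positivity) (Real.exp_le_one_iff.2 ?_)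
  have : 0 ≤ (A.card - A'.card : ℝ) / F := div_nonneg (by linarith) hF.le
  linarith

/-- Cauchy–Schwarz. It is the reason for normalising `∑ w⁻¹` by the square of the number of nodes in
the potential. -/
lemma sq_card_le_sum_mul_sum_inv (hw : ∀ v ∈ A, 0 < w v) :
    (A.card : ℝ) ^ 2 ≤ (∑ v ∈ A, w v) * ∑ v ∈ A, (w v)⁻¹ := by
  simpa using Finset.sum_sq_le_sum_mul_sum_of_sq_le_mul A (r := fun _ => (1 : ℝ)) (f := w)
    (g := fun v => (w v)⁻¹) (fun v hv => (hw v hv).le) (fun v hv => (inv_pos.2 (hw v hv)).le)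
    (fun v hv => by simp [mul_inv_cancel₀ (hw v hv).ne'])

/-- While more than `M` nodes are left, the potential is at least `1`. -/
lemma one_le_potential (hF : 0 < F) (hβ : 0 ≤ β) (hA : M < A.card) (hw : ∀ v ∈ A, 0 < w v) :
    1 ≤ potential F M β A w := by
  have hm : 0 < A.card := by omega
  have hne : A.Nonempty := Finset.card_pos.1 hm
  have h1 : 0 < ∑ v ∈ A, w v := Finset.sum_pos hw hne
  have h2 : 0 < ∑ v ∈ A, (w v)⁻¹ := Finset.sum_pos (fun v hv => inv_pos.2 (hw v hv)) hne
  have hcs := sq_card_le_sum_mul_sum_inv hw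
  rw [potential, if_neg (by omega)]
  refine one_le_mul_of_one_le_of_one_le (Real.one_le_exp (by positivity)) (Real.one_le_rpow ?_ hβ)
  rw [← mul_div_assoc, one_le_div (by positivity)]
  refine hcs.trans ?_
  rw [← mul_assoc]
  gcongr
  have : (∑ v ∈ A, w v) = (∑ v ∈ A, w v) / F * F := by field_simp
  conv_lhs => rw [this]
  gcongr
  have h3 : 0 ≤ (∑ v ∈ A, w v) / F := by positivity
  calc (∑ v ∈ A, w v) / F ≤ 1 + (∑ v ∈ A, w v) / F := by linarith
    _ ≤ _ := le_self_pow₀ (by linarith) (by norm_num)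

/-- Upper bound for the potential when all probabilities lie in `[ε, 1]`. -/
lemma potential_le (hF : 1 ≤ F) (hβ : 0 ≤ β) (hβ1 : β ≤ 1) {ε : ℝ} (hε : 0 < ε) (hε1 : ε ≤ 1)
    (hw : ∀ v ∈ A, ε ≤ w v) (hw1 : ∀ v ∈ A, w v ≤ 1) (hM : F ≤ M + 1) :
    potential F M β A w ≤ Real.exp (6 * A.card / F) / ε := by
  have hF0 : 0 < F := by linarith
  rw [potential]
  split_ifs with h
  · positivity
  have hmF : F ≤ A.card := hM.trans (by exact_mod_cast not_le.1 h)
  have hm : (0 : ℝ) < A.card := by linarith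
  have hS : ∑ v ∈ A, (w v)⁻¹ ≤ A.card * ε⁻¹ := by
    rw [← nsmul_eq_mul]
    exact Finset.sum_le_card_nsmul _ _ _ fun v hv => inv_anti₀ hε (hw v hv)
  have hP : ∑ v ∈ A, w v ≤ A.card := by
    simpa using Finset.sum_le_card_nsmul _ _ (1 : ℝ) hw1
  have hP0 : 0 ≤ ∑ v ∈ A, w v := Finset.sum_nonneg fun v hv => hε.le.trans (hw v hv)
  have hS0 : 0 ≤ ∑ v ∈ A, (w v)⁻¹ :=
    Finset.sum_nonneg fun v hv => inv_nonneg.2 (hε.le.trans (hw v hv))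
  have hG : (1 + (∑ v ∈ A, w v) / F) ^ 4 * (F * (∑ v ∈ A, (w v)⁻¹) / (A.card : ℝ) ^ 2) ≤
      Real.exp (4 * A.card / F) * ε⁻¹ := by
    have e1 : (1 + (∑ v ∈ A, w v) / F) ^ 4 ≤ Real.exp (4 * A.card / F) := by
      calc (1 + (∑ v ∈ A, w v) / F) ^ 4 ≤ Real.exp (A.card / F) ^ 4 := by
            gcongr
            have := Real.add_one_le_exp (A.card / F : ℝ)
            have : (∑ v ∈ A, w v) / F ≤ A.card / F := by gcongr
            linarith
        _ = _ := by rw [← Real.exp_nat_mul]; congr 1; push_cast; ring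
    have e2 : F * (∑ v ∈ A, (w v)⁻¹) / (A.card : ℝ) ^ 2 ≤ ε⁻¹ := by
      rw [div_le_iff₀ (by positivity)]
      calc F * ∑ v ∈ A, (w v)⁻¹ ≤ A.card * (A.card * ε⁻¹) := by gcongr
        _ = _ := by ring
    gcongr
  -- The bound for the base is at least `1`, so raising the exponent `β` to `1` can only increase
  -- it.
  have hone : 1 ≤ Real.exp (4 * A.card / F) * ε⁻¹ :=
    one_le_mul_of_one_le_of_one_le (Real.one_le_exp (by positivity)) ((one_le_inv₀ hε).2 hε1)
  calc _ ≤ Real.exp (2 * A.card / F) * (Real.exp (4 * A.card / F) * ε⁻¹) := by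
        gcongr
        refine (Real.rpow_le_rpow (by positivity) hG hβ).trans ?_
        exact (Real.rpow_le_rpow_of_exponent_le hone hβ1).trans (by simp)
    _ = _ := by
        rw [← mul_assoc, ← Real.exp_add, div_eq_mul_inv]
        congr 2
        ring

/-- One random step contracts the potential in the mean. -/
lemma sum_potential_le {Ω : Type*} [Fintype Ω] {P : Ω → ℝ} {B : Ω → Finset ι} {u : Ω → ι → ℝ}
    {a s : ℝ} (hP : ∀ ω, 0 ≤ P ω) (hP1 : ∑ ω, P ω = 1) (hF : 0 < F) (hM : F ≤ M + 1)
    (hw : ∀ v ∈ A, 0 < w v) (hB : ∀ ω, B ω ⊆ A) (hBF : ∀ ω, (A.card - (B ω).card : ℝ) ≤ F)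
    (hu : ∀ ω, ∀ v ∈ A, u ω v ≤ 2 * w v) (hu2 : ∀ ω, ∀ v ∈ A, w v / 2 ≤ u ω v)
    (ha : a ≤ 1 / 100) (hs : 0 < s) (hs1 : s ≤ 1)
    (high : M < A.card → 4 * F ≤ ∑ v ∈ A, w v →
      ∑ ω, P ω * ∑ v ∈ A, u ω v ≤ 11 / 20 * ∑ v ∈ A, w v)
    (low : M < A.card → ∑ v ∈ A, w v ≤ a * F →
      ∑ ω, P ω * ∑ v ∈ A, (u ω v)⁻¹ ≤ 3 / 5 * ∑ v ∈ A, (w v)⁻¹)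
    (mid : M < A.card → a * F ≤ ∑ v ∈ A, w v → ∑ v ∈ A, w v ≤ 4 * F →
      s * F ≤ ∑ ω, P ω * (A.card - (B ω).card : ℝ)) :
    ∑ ω, P ω * potential F M (s / 16) (B ω) (u ω) ≤
      Real.exp (-(s / 64)) * potential F M (s / 16) A w := by
  by_cases h : A.card ≤ M
  · rw [potential, if_pos h, mul_zero]
    refine (Finset.sum_eq_zero fun ω _ => ?_).le
    rw [potential, if_pos ((Finset.card_le_card (hB ω)).trans h), mul_zero]
  have h' := not_le.1 h
  have hne : A.Nonempty := Finset.card_pos.1 (by omega)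
  have hm : (0 : ℝ) < A.card := by exact_mod_cast Finset.card_pos.2 hne
  have h1 : 0 < ∑ v ∈ A, w v := Finset.sum_pos hw hne
  have h2 : 0 < ∑ v ∈ A, (w v)⁻¹ := Finset.sum_pos (fun v hv => inv_pos.2 (hw v hv)) hne
  have hu0 : ∀ ω, ∀ v ∈ A, 0 < u ω v := fun ω v hv => by linarith [hw v hv, hu2 ω v hv]
  have hcard : ∀ ω, ((B ω).card : ℝ) ≤ A.card := fun ω => by
    exact_mod_cast Finset.card_le_card (hB ω)
  have main := sum_exp_mul_rpow_le (w := P) (Y' := fun ω => (∑ v ∈ A, u ω v) / F)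
    (S' := fun ω => F * (∑ v ∈ A, (u ω v)⁻¹) / (A.card : ℝ) ^ 2)
    (D := fun ω => (A.card - (B ω).card : ℝ) / F) (Y := (∑ v ∈ A, w v) / F)
    (S := F * (∑ v ∈ A, (w v)⁻¹) / (A.card : ℝ) ^ 2) (a := a) (s := s) hP hP1 (by positivity)
    (by positivity)
    (fun ω => div_nonneg (Finset.sum_nonneg fun v hv => (hu0 ω v hv).le) hF.le)
    (fun ω => by
      rw [← mul_div_assoc, Finset.mul_sum]
      gcongr with v hv
      exact hu ω v hv)
    (fun ω => by
      have := Finset.sum_nonneg fun v hv => (inv_pos.2 (hu0 ω v hv)).le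
      positivity)
    (fun ω => by
      rw [← mul_div_assoc, ← mul_assoc, mul_comm 2 F, mul_assoc, Finset.mul_sum (a := 2)]
      refine div_le_div_of_nonneg_right (mul_le_mul_of_nonneg_left
        (Finset.sum_le_sum fun v hv => ?_) hF.le) (by positivity)
      have := hw v hv
      calc (u ω v)⁻¹ ≤ (w v / 2)⁻¹ := inv_anti₀ (by positivity) (hu2 ω v hv)
        _ = 2 * (w v)⁻¹ := by rw [inv_div]; ring)
    (fun ω => div_nonneg (by linarith [hcard ω]) hF.le)
    (fun ω => (div_le_one hF).2 (hBF ω)) ha hs hs1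
    (fun hY => by
      have := high h' ((le_div_iff₀ hF).1 hY)
      simp only [← mul_div_assoc, ← Finset.sum_div]
      gcongr)
    (fun hY => by
      have := low h' ((div_le_iff₀ hF).1 hY)
      calc _ = F / (A.card : ℝ) ^ 2 * ∑ ω, P ω * ∑ v ∈ A, (u ω v)⁻¹ := by
            rw [Finset.mul_sum]; refine Finset.sum_congr rfl fun ω _ => by ring
        _ ≤ F / (A.card : ℝ) ^ 2 * (3 / 5 * ∑ v ∈ A, (w v)⁻¹) := by gcongr
        _ = _ := by ring)
    (fun hY hY4 => by
      have := mid h' ((le_div_iff₀ hF).1 hY) ((div_le_iff₀ hF).1 hY4)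
      simp only [← mul_div_assoc, ← Finset.sum_div]
      rwa [le_div_iff₀ hF])
  calc _ ≤ Real.exp (2 * A.card / F) * ∑ ω, P ω * (Real.exp (-((A.card - (B ω).card : ℝ) / F)) *
        ((1 + (∑ v ∈ A, u ω v) / F) ^ 4 *
          (F * (∑ v ∈ A, (u ω v)⁻¹) / (A.card : ℝ) ^ 2)) ^ (s / 16)) := by
        rw [Finset.mul_sum]
        refine Finset.sum_le_sum fun ω _ => ?_
        rw [mul_left_comm]
        exact mul_le_mul_of_nonneg_left (potential_le_of_subset hF hM (by positivity)
          (by linarith) (hB ω) fun v hv => (hu0 ω v hv).le) (hP ω)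
    _ ≤ _ := mul_le_mul_of_nonneg_left main (Real.exp_pos _).le
    _ = _ := by rw [potential, if_neg h]; ring

end

/-! ## Deterministic facts about the protocol -/

section

variable {n F : ℕ}

lemma mem_transmitters {a : Fin n → Action n F} {c : Fin F} {u : Fin n} :
    u ∈ transmitters a c ↔ ∃ m, a u = .transmit c m := by
  simp only [transmitters, Finset.mem_filter, Finset.mem_univ, true_and]
  cases h : a u <;> simp [Action.TransmitsOn]

lemma observe_eq_silence {a : Fin n → Action n F} {v : Fin n} :
    observe a v = .silence ↔ ∃ c, a v = .listen c ∧ transmitters a c = ∅ := by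
  unfold observe
  cases h : a v with
  | listen c =>
    simp only [Action.listen.injEq, exists_eq_left', ← Finset.card_eq_zero]
    split_ifs <;> simp_all
  | _ => simp

lemma observe_listen_of_singleton {a : Fin n → Action n F} {v w : Fin n} {c : Fin F}
    {m : Finset (Fin n)} (hw : a w = .listen c) (hv : a v = .transmit c m)
    (h : transmitters a c = {v}) : observe a w = .message m := by
  simp [observe, hw, h, hv, Action.payload]

/-- A node is acknowledged iff it is the only transmitter on its channel and somebody listens. -/
lemma acknowledged_iff {a : Fin n → Action n F} {v : Fin n} :
    Acknowledged a v ↔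
      ∃ c m, a v = .transmit c m ∧ transmitters a c = {v} ∧ ∃ w, a w = .listen c := by
  constructor
  · rintro ⟨ht, hb⟩
    cases hv : a v with
    | off => simp [hv, Action.Transmits] at ht
    | listen c => simp [hv, Action.Transmits] at ht
    | transmit c m =>
      refine ⟨c, m, rfl, ?_⟩
      have hne : (transmitters (ackActions a) c).Nonempty := by
        rw [Finset.nonempty_iff_ne_empty]
        intro h
        have : observe (ackActions a) v = .silence :=
          observe_eq_silence.2 ⟨c, by simp [ackActions, hv], h⟩
        simp [this, Observation.Busy] at hb
      obtain ⟨w, hw⟩ := hne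
      obtain ⟨m', hw⟩ := mem_transmitters.1 hw
      cases haw : a w with
      | off => simp [ackActions, haw] at hw
      | transmit d m'' => simp [ackActions, haw] at hw
      | listen d =>
        simp only [ackActions, haw] at hw
        split_ifs at hw with hmsg
        simp only [Action.transmit.injEq] at hw
        obtain ⟨rfl, -⟩ := hw
        refine ⟨?_, w, haw⟩
        have hmem : v ∈ transmitters a d := mem_transmitters.2 ⟨m, hv⟩
        simp only [observe, haw] at hmsg
        split_ifs at hmsg with h0 h1
        · simp [Observation.IsMessage] at hmsg
        · obtain ⟨x, hx⟩ := Finset.card_eq_one.1 h1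
          rw [hx] at hmem ⊢
          rw [Finset.mem_singleton.1 hmem]
        · simp [Observation.IsMessage] at hmsg
  · rintro ⟨c, m, hv, ht, w, hw⟩
    refine ⟨by simp [hv, Action.Transmits], ?_⟩
    have hmem : w ∈ transmitters (ackActions a) c := mem_transmitters.2
      ⟨∅, by simp [ackActions, hw, observe_listen_of_singleton hw hv ht, Observation.IsMessage]⟩
    have h0 : (transmitters (ackActions a) c).card ≠ 0 := Finset.card_ne_zero_of_mem hmem
    simp only [observe, ackActions, hv]
    rw [if_neg h0]
    split_ifs <;> simp [Observation.Busy]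

/-! ### Survival of packets and of active nodes -/

/-- The packet `κ` is known to an active node or, if nobody is active, to everybody. -/
def Kept (κ : Fin n) (x : Config n) : Prop :=
  (x.active.Nonempty → ∃ v ∈ x.active, κ ∈ x.known v) ∧ (x.active = ∅ → ∀ u, κ ∈ x.known u)

/-- Facts shared by the two kinds of half-rounds. -/
structure Progress (x y : Config n) : Prop where
  active_subset : y.active ⊆ x.active
  kept : ∀ κ, Kept κ x → Kept κ y
  nonempty : 2 ≤ x.active.card → y.active.Nonempty

lemma multiActions_eq_transmit {x : Config n} {r : Fin n → Fin F × Bool} {v : Fin n} {c : Fin F}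
    {m : Finset (Fin n)} : multiActions x r v = .transmit c m ↔
      v ∈ x.active ∧ (r v).2 = true ∧ (r v).1 = c ∧ x.known v = m := by
  unfold multiActions
  split_ifs <;> simp_all

lemma multiActions_eq_listen {x : Config n} {r : Fin n → Fin F × Bool} {v : Fin n} {c : Fin F} :
    multiActions x r v = .listen c ↔ v ∈ x.active ∧ (r v).2 = false ∧ (r v).1 = c := by
  unfold multiActions
  split_ifs <;> simp_all

lemma primaryActions_eq_transmit [NeZero F] {x : Config n} {b : Fin n → Bool} {v : Fin n}
    {c : Fin F} {m : Finset (Fin n)} : (primaryActions x b v : Action n F) = .transmit c m ↔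
      v ∈ x.active ∧ b v = true ∧ 0 = c ∧ x.known v = m := by
  unfold primaryActions
  split_ifs <;> simp_all

lemma primaryActions_eq_listen [NeZero F] {x : Config n} {b : Fin n → Bool} {v : Fin n}
    {c : Fin F} : (primaryActions x b v : Action n F) = .listen c ↔
      ¬ (v ∈ x.active ∧ b v = true) ∧ 0 = c := by
  unfold primaryActions
  split_ifs <;> simp_all

/-- In the multi-channel slots only active nodes listen. The listener that acknowledges a sender is
therefore active, stays active, and has just learned the sender's packets; in particular these slots
never empty a nonempty active set. -/
lemma progress_afterMulti (ζ : ℝ≥0) (x : Config n) (r : Fin n → Fin F × Bool) :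
    Progress x (afterMulti ζ x r) := by
  classical
  have hstay : ∀ w ∈ x.active, (r w).2 = false → w ∈ (afterMulti ζ x r).active := by
    intro w hw hr
    simp only [afterMulti, Finset.mem_filter, acknowledged_iff, multiActions_eq_transmit]
    refine ⟨hw, ?_⟩
    rintro ⟨c, m, ⟨-, h, -⟩, -⟩
    simp [hr] at h
  have hnext : ∀ v ∈ x.active, ∃ w ∈ (afterMulti ζ x r).active,
      x.known v ⊆ (afterMulti ζ x r).known w := by
    intro v hv
    by_cases hack : Acknowledged (multiActions x r) v
    · obtain ⟨c, m, h1, h2, w, h3⟩ := acknowledged_iff.1 hack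
      have hw := multiActions_eq_listen.1 h3
      refine ⟨w, hstay w hw.1 hw.2.1, ?_⟩
      have hm := (multiActions_eq_transmit.1 h1).2.2.2
      simp only [afterMulti, observe_listen_of_singleton h3 h1 h2, Observation.packets, hm]
      exact Finset.subset_union_right
    · exact ⟨v, by simp [afterMulti, hv, hack], by simp [afterMulti]⟩
  refine ⟨Finset.filter_subset _ _, fun κ hκ => ⟨fun hne => ?_, fun he u => ?_⟩, fun h2 => ?_⟩
  · obtain ⟨v, hv, hk⟩ := hκ.1 (hne.mono (Finset.filter_subset _ _))
    obtain ⟨w, hw, hsub⟩ := hnext v hv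
    exact ⟨w, hw, hsub hk⟩
  · have : x.active = ∅ := by
      by_contra h
      obtain ⟨v, hv⟩ := Finset.nonempty_iff_ne_empty.2 h
      obtain ⟨w, hw, -⟩ := hnext v hv
      simp [he] at hw
    exact Finset.mem_union_left _ (hκ.2 this u)
  · obtain ⟨v, hv⟩ := Finset.card_pos.1 (by omega : 0 < x.active.card)
    obtain ⟨w, hw, -⟩ := hnext v hv
    exact ⟨w, hw⟩

/-- Here inactive nodes listen too, so even the last active node may drop out. An acknowledged node
was the only transmitter, hence every other node has its packets and every other active node
remains. -/
lemma progress_afterPrimary [NeZero F] (ζ : ℝ≥0) (x : Config n) (b : Fin n → Bool) :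
    Progress x (afterPrimary F ζ x b) := by
  classical
  have hspread : ∀ v, Acknowledged (primaryActions x b : Fin n → Action n F) v →
      ∀ w, w ≠ v → (w ∈ x.active → w ∈ (afterPrimary F ζ x b).active) ∧
        x.known v ⊆ (afterPrimary F ζ x b).known w := by
    intro v hack w hwv
    obtain ⟨c, m, h1, h2, -⟩ := acknowledged_iff.1 hack
    obtain ⟨-, -, rfl, hm⟩ := primaryActions_eq_transmit.1 h1
    have hwb : ¬ (w ∈ x.active ∧ b w = true) := fun h => hwv <| by
      have : w ∈ transmitters (primaryActions x b : Fin n → Action n F) 0 :=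
        mem_transmitters.2 ⟨_, primaryActions_eq_transmit.2 ⟨h.1, h.2, rfl, rfl⟩⟩
      simpa [h2] using this
    constructor
    · intro hw
      simp only [afterPrimary, Finset.mem_filter, acknowledged_iff, primaryActions_eq_transmit]
      refine ⟨hw, ?_⟩
      rintro ⟨c, m, ⟨-, h, -⟩, -⟩
      exact hwb ⟨hw, h⟩
    · simp only [afterPrimary, Observation.packets, hm,
        observe_listen_of_singleton (primaryActions_eq_listen.2 ⟨hwb, rfl⟩) h1 h2]
      exact Finset.subset_union_right
  have hstay : ∀ v ∈ x.active, ¬ Acknowledged (primaryActions x b : Fin n → Action n F) v →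
      v ∈ (afterPrimary F ζ x b).active := fun v hv h => by simp [afterPrimary, hv, h]
  have hknown : ∀ u, x.known u ⊆ (afterPrimary F ζ x b).known u :=
    fun u => Finset.subset_union_left
  refine ⟨Finset.filter_subset _ _, fun κ hκ => ⟨fun hne => ?_, fun he u => ?_⟩, fun h2 => ?_⟩
  · obtain ⟨v, hv, hk⟩ := hκ.1 (hne.mono (Finset.filter_subset _ _))
    by_cases hack : Acknowledged (primaryActions x b : Fin n → Action n F) v
    · obtain ⟨w, hw⟩ := hne
      have hwv : w ≠ v := by
        rintro rfl
        exact (Finset.mem_filter.1 hw).2 hack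
      exact ⟨w, hw, (hspread v hack w hwv).2 hk⟩
    · exact ⟨v, hstay v hv hack, hknown v hk⟩
  · rcases x.active.eq_empty_or_nonempty with h | h
    · exact hknown u (hκ.2 h u)
    · obtain ⟨v, hv, hk⟩ := hκ.1 h
      by_cases hack : Acknowledged (primaryActions x b : Fin n → Action n F) v
      · by_cases huv : u = v
        · exact huv ▸ hknown v hk
        · exact (hspread v hack u huv).2 hk
      · simpa [he] using hstay v hv hack
  · obtain ⟨v, hv, w, hw, hvw⟩ := Finset.one_lt_card.1 h2
    by_cases hack : Acknowledged (primaryActions x b : Fin n → Action n F) v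
    · exact ⟨w, (hspread v hack w hvw.symm).1 hw⟩
    · exact ⟨v, hstay v hv hack⟩

lemma progress_of_mem_support [NeZero F] {ζ : ℝ≥0} {h : ℕ} {x y : Config n}
    (hy : y ∈ (halfRound F ζ h x).support) : Progress x y := by
  unfold halfRound at hy
  split_ifs at hy
  · obtain ⟨r, -, rfl⟩ := (PMF.mem_support_map_iff _ _ _).1 hy
    exact progress_afterMulti ζ x r
  · obtain ⟨r, -, rfl⟩ := (PMF.mem_support_map_iff _ _ _).1 hy
    exact progress_afterPrimary ζ x r

/-- If nobody is active at the end of a path that started with the source nodes, then exactly one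
node was active at some earlier moment, and everybody knows all packets at any later moment. -/
lemma exists_sole_of_path {K : Finset (Fin n)} {ζ : ℝ≥0} {x : ℕ → Config n} {H H' : ℕ}
    (hK : K.Nonempty) (h0 : x 0 = init ζ K) (hHH : H ≤ H')
    (hstep : ∀ h < H', Progress (x h) (x (h + 1))) (hH : (x H).active = ∅) :
    ∃ v, (∃ h ≤ H, (x h).active = {v}) ∧ v ∉ (x H').active ∧ ∀ u, K ⊆ (x H').known u := by
  classical
  have hex : ∃ h, (x h).active = ∅ := ⟨H, hH⟩
  have hfind : Nat.find hex ≤ H := Nat.find_min' hex hH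
  have hempty : (x H').active = ∅ := by
    have : ∀ d, H + d ≤ H' → (x (H + d)).active = ∅ := by
      intro d
      induction d with
      | zero => exact fun _ => hH
      | succ d ih =>
        intro hd
        exact Finset.subset_empty.1 ((ih (by omega)) ▸ (hstep (H + d) (by omega)).active_subset)
    simpa [Nat.add_sub_cancel' hHH] using this (H' - H) (by omega)
  have hkept : ∀ κ ∈ K, ∀ h ≤ H', Kept κ (x h) := by
    intro κ hκ h
    induction h with
    | zero =>
      intro _
      rw [h0]
      exact ⟨fun _ => ⟨κ, hκ, by simp [init, hκ]⟩, fun he => by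
        simp only [init] at he
        simp [he] at hκ⟩
    | succ h ih => exact fun hh => (hstep h (by omega)).kept κ (ih (by omega))
  have hpos : 0 < Nat.find hex := by
    rw [Nat.pos_iff_ne_zero]
    intro h
    have := Nat.find_spec hex
    rw [h, h0] at this
    exact hK.ne_empty this
  -- `j` is the last moment before the active set first becomes empty; two or more active nodes at
  -- `j` would have left a survivor.
  obtain ⟨j, hj⟩ := Nat.exists_eq_succ_of_ne_zero hpos.ne'
  have hjne : (x j).active ≠ ∅ := Nat.find_min hex (by omega)
  have hj1 : (x j).active.card = 1 := by
    have h1 := Finset.card_pos.2 (Finset.nonempty_iff_ne_empty.2 hjne)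
    by_contra hne
    have := (hstep j (by omega)).nonempty (by omega)
    rw [← Nat.succ_eq_add_one, ← hj, Nat.find_spec hex] at this
    simp at this
  obtain ⟨v, hv⟩ := Finset.card_eq_one.1 hj1
  exact ⟨v, ⟨j, by omega, hv⟩, by simp [hempty], fun u κ hκ =>
    (hkept κ hκ H' le_rfl).2 hempty u⟩

end

section

/-! ## Independent draws with real weights -/

section Product

variable {ι α : Type*} [Fintype ι] [DecidableEq ι] [Fintype α]

lemma sum_prod_weights {w : ι → α → ℝ} (hw : ∀ i, ∑ a, w i a = 1) :
    ∑ ω : ι → α, ∏ i, w i (ω i) = 1 := by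
  rw [← Fintype.piFinset_univ, ← Finset.prod_univ_sum]
  exact Finset.prod_eq_one fun i _ => hw i

/-- Independence: the mean of a product of functions of distinct coordinates. -/
lemma sum_prod_weights_mul {w : ι → α → ℝ} (hw : ∀ i, ∑ a, w i a = 1) {v : ι} {B : Finset ι}
    (hv : v ∉ B) (g : α → ℝ) (φ : ι → α → ℝ) :
    ∑ ω : ι → α, (∏ i, w i (ω i)) * (g (ω v) * ∏ u ∈ B, φ u (ω u)) =
      (∑ a, w v a * g a) * ∏ u ∈ B, ∑ a, w u a * φ u a := by
  set χ : ι → α → ℝ := Function.update φ v g with hχ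
  have hχv : χ v = g := by simp [hχ]
  have hχu : ∀ u ∈ B, χ u = φ u := fun u hu => by
    rw [hχ, Function.update_of_ne]
    rintro rfl
    exact hv hu
  -- Padding with the factor `1` outside `insert v B` makes the product run over all coordinates, so
  -- that the sum factorises.
  set ψ : ι → α → ℝ := fun u a => if u ∈ insert v B then χ u a else 1 with hψ
  have h1 : ∀ ω : ι → α, g (ω v) * ∏ u ∈ B, φ u (ω u) = ∏ u, ψ u (ω u) := fun ω => by
    rw [hψ, Finset.prod_ite_mem, Finset.univ_inter, Finset.prod_insert hv, hχv]
    congr 1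
    exact Finset.prod_congr rfl fun u hu => by rw [hχu u hu]
  have h2 : ∀ u, ∑ a, w u a * ψ u a = if u ∈ insert v B then ∑ a, w u a * χ u a else 1 :=
    fun u => by
      by_cases h : u ∈ insert v B
      · simp only [hψ, if_pos h]
      · simp only [hψ, if_neg h, mul_one, hw]
  calc _ = ∑ ω : ι → α, ∏ u, w u (ω u) * ψ u (ω u) :=
        Finset.sum_congr rfl fun ω _ => by rw [h1, Finset.prod_mul_distrib]
    _ = ∏ u, ∑ a, w u a * ψ u a := by
        rw [Finset.prod_univ_sum, Fintype.piFinset_univ]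
    _ = _ := by
        simp only [h2]
        rw [Finset.prod_ite_mem, Finset.univ_inter, Finset.prod_insert hv, hχv]
        congr 1
        exact Finset.prod_congr rfl fun u hu => by rw [hχu u hu]

end Product

/-- The mean of a two-valued function depends only on the probability of the event, which reduces
the update rule to the chance of silence. -/
lemma sum_mul_ite {Ω : Type*} [Fintype Ω] {P : Ω → ℝ} (hP : ∑ ω, P ω = 1) (E : Ω → Prop)
    [DecidablePred E] (x y : ℝ) :
    ∑ ω, P ω * (if E ω then x else y) =
      y + (∑ ω, P ω * (if E ω then 1 else 0)) * (x - y) := by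
  have : ∀ ω, P ω * (if E ω then x else y) =
      P ω * y + P ω * (if E ω then 1 else 0) * (x - y) := fun ω => by split_ifs <;> ring
  simp only [this, Finset.sum_add_distrib, ← Finset.sum_mul, hP, one_mul]

/-! ## The chance of silence -/

section Silence

variable {ι : Type*} [DecidableEq ι] {A : Finset ι} {w : ι → ℝ} {F ζ : ℝ} {v : ι}

/-- Weierstrass' product inequality. -/
lemma one_sub_sum_le_prod {s : Finset ι} {f : ι → ℝ} (h0 : ∀ i ∈ s, 0 ≤ f i)
    (h1 : ∀ i ∈ s, f i ≤ 1) : 1 - ∑ i ∈ s, f i ≤ ∏ i ∈ s, (1 - f i) := by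
  induction s using Finset.induction_on with
  | empty => simp
  | insert a s ha ih =>
    rw [Finset.sum_insert ha, Finset.prod_insert ha]
    have hs := ih (fun i hi => h0 i (Finset.mem_insert_of_mem hi))
      fun i hi => h1 i (Finset.mem_insert_of_mem hi)
    have hsum := Finset.sum_nonneg fun i hi => h0 i (Finset.mem_insert_of_mem (a := i) hi)
    have ha0 := h0 a (Finset.mem_insert_self a s)
    have ha1 := h1 a (Finset.mem_insert_self a s)
    nlinarith [mul_le_mul_of_nonneg_left hs (by linarith : 0 ≤ 1 - f a), mul_nonneg ha0 hsum]

/-- The probability that an active node `v` hears silence when every active node `u` transmits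
with probability `w u` on one of `F` channels. -/
noncomputable def silenceProb (F : ℝ) (A : Finset ι) (w : ι → ℝ) (v : ι) : ℝ :=
  (1 - w v) * ∏ u ∈ A.erase v, (1 - w u / F)

/-- Weakening the node's own factor `1 - w v` to `1 - w v / F` completes the product over `A`; then
`1 - x ≤ exp (-x)`. -/
lemma silenceProb_le (hF : 1 ≤ F) (hv : v ∈ A) (hw : ∀ u ∈ A, 0 ≤ w u) (hw1 : ∀ u ∈ A, w u ≤ 1) :
    silenceProb F A w v ≤ Real.exp (-((∑ u ∈ A, w u) / F)) := by
  have hF0 : 0 < F := by linarith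
  have hdiv : ∀ u ∈ A, w u / F ≤ w u := fun u hu => div_le_self (hw u hu) hF
  have h0 : ∀ u ∈ A, 0 ≤ 1 - w u / F := fun u hu => by linarith [hdiv u hu, hw1 u hu]
  calc silenceProb F A w v ≤ (1 - w v / F) * ∏ u ∈ A.erase v, (1 - w u / F) := by
        refine mul_le_mul_of_nonneg_right (by linarith [hdiv v hv]) ?_
        exact Finset.prod_nonneg fun u hu => h0 u (Finset.mem_of_mem_erase hu)
    _ = ∏ u ∈ A, (1 - w u / F) := Finset.mul_prod_erase A (fun u => 1 - w u / F) hv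
    _ ≤ ∏ u ∈ A, Real.exp (-(w u / F)) := Finset.prod_le_prod h0 fun u _ => by
        linarith [Real.add_one_le_exp (-(w u / F))]
    _ = _ := by rw [← Real.exp_sum, Finset.sum_neg_distrib, Finset.sum_div]

lemma silenceProb_nonneg (hF : 1 ≤ F) (hv : v ∈ A) (hw : ∀ u ∈ A, 0 ≤ w u)
    (hw1 : ∀ u ∈ A, w u ≤ 1) : 0 ≤ silenceProb F A w v := by
  refine mul_nonneg (by linarith [hw1 v hv]) (Finset.prod_nonneg fun u hu => ?_)
  have hu := Finset.mem_of_mem_erase hu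
  linarith [div_le_self (hw u hu) hF, hw1 u hu]

lemma le_silenceProb (hF : 1 ≤ F) (hv : v ∈ A) (hw : ∀ u ∈ A, 0 ≤ w u) (hw1 : ∀ u ∈ A, w u ≤ 1) :
    1 - w v - (∑ u ∈ A, w u) / F ≤ silenceProb F A w v := by
  have hF0 : 0 < F := by linarith
  have hdiv : ∀ u ∈ A, w u / F ≤ w u := fun u hu => div_le_self (hw u hu) hF
  have h1 : 1 - ∑ u ∈ A.erase v, w u / F ≤ ∏ u ∈ A.erase v, (1 - w u / F) := by
    refine one_sub_sum_le_prod (fun u hu => ?_) fun u hu => ?_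
    · exact div_nonneg (hw u (Finset.mem_of_mem_erase hu)) hF0.le
    · have hu := Finset.mem_of_mem_erase hu
      linarith [hdiv u hu, hw1 u hu]
  have h2 : ∑ u ∈ A.erase v, w u / F ≤ (∑ u ∈ A, w u) / F := by
    rw [Finset.sum_div]
    exact Finset.sum_le_sum_of_subset_of_nonneg (Finset.erase_subset _ _) fun u hu _ =>
      div_nonneg (hw u hu) hF0.le
  have h3 : 0 ≤ (∑ u ∈ A, w u) / F := div_nonneg (Finset.sum_nonneg hw) hF0.le
  have hv0 := hw v hv
  have hv1 := hw1 v hv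
  unfold silenceProb
  nlinarith [mul_le_mul_of_nonneg_left h1 (by linarith : 0 ≤ 1 - w v), mul_nonneg hv0 h3]

/-- Rests on `exp (-2x) ≤ 1 - x` for `0 ≤ x ≤ 1/2`; this is what keeps the chance of success bounded
below at moderate contention. -/
lemma exp_le_prod_erase (hF : 1 ≤ F) (hw : ∀ u ∈ A, 0 ≤ w u) (hw1 : ∀ u ∈ A, w u ≤ 1 / 2) :
    Real.exp (-(2 * ((∑ u ∈ A, w u) / F))) ≤ ∏ u ∈ A.erase v, (1 - w u / F) := by
  have hF0 : 0 < F := by linarith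
  calc Real.exp (-(2 * ((∑ u ∈ A, w u) / F))) ≤
        Real.exp (-(2 * ((∑ u ∈ A.erase v, w u) / F))) := by
        gcongr 1
        have := Finset.sum_le_sum_of_subset_of_nonneg (Finset.erase_subset v A)
          (fun u hu _ => hw u hu)
        gcongr
    _ = ∏ u ∈ A.erase v, Real.exp (-(2 * (w u / F))) := by
        rw [← Real.exp_sum, Finset.sum_neg_distrib, Finset.sum_div, Finset.mul_sum]
    _ ≤ _ := Finset.prod_le_prod (fun _ _ => (Real.exp_pos _).le) fun u hu => by
        have hu := Finset.mem_of_mem_erase hu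
        have h0 : 0 ≤ w u / F := div_nonneg (hw u hu) hF0.le
        have h1 : w u / F ≤ 1 / 2 := (div_le_self (hw u hu) hF).trans (hw1 u hu)
        rw [Real.exp_neg, inv_le_comm₀ (Real.exp_pos _) (by linarith)]
        refine le_trans ?_ (Real.add_one_le_exp _)
        rw [inv_le_iff_one_le_mul₀ (by linarith)]
        nlinarith

/-! ### Mean effect of the update rule -/

variable {Ω : Type*} [Fintype Ω] {P : Ω → ℝ} {E : ι → Ω → Prop} [∀ v, DecidablePred (E v)]

/-- If there are many competitors, the update rule decreases the transmission probabilities. -/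
lemma sum_update_le (hP1 : ∑ ω, P ω = 1) (hF : 1 ≤ F)
    (hw : ∀ u ∈ A, 0 ≤ w u) (hw1 : ∀ u ∈ A, w u ≤ 1)
    (hE : ∀ v ∈ A, ∑ ω, P ω * (if E v ω then 1 else 0) = silenceProb F A w v)
    (hY : 4 * F ≤ ∑ u ∈ A, w u) :
    ∑ ω, P ω * ∑ v ∈ A, (if E v ω then min ζ (2 * w v) else w v / 2) ≤
      11 / 20 * ∑ v ∈ A, w v := by
  have hF0 : 0 < F := by linarith
  simp only [Finset.mul_sum]
  rw [Finset.sum_comm]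
  refine Finset.sum_le_sum fun v hv => ?_
  rw [sum_mul_ite hP1, hE v hv]
  -- Silence raises the new value by at most `3/2 * w v` over `w v / 2`, so chance `1/30` gives `1/2
  -- + 1/20 = 11/20`.
  have h1 : silenceProb F A w v ≤ 1 / 30 := by
    refine (silenceProb_le hF hv hw hw1).trans ?_
    calc Real.exp (-((∑ u ∈ A, w u) / F)) ≤ Real.exp (-4) := by
          gcongr
          rwa [le_div_iff₀ hF0]
      _ ≤ 1 / 30 := by
          have h : (30 : ℝ) ≤ Real.exp 4 := by
            have := Real.exp_one_gt_d9
            calc (30 : ℝ) ≤ 2.7182818283 ^ 4 := by norm_num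
              _ ≤ Real.exp 1 ^ 4 := by gcongr
              _ = Real.exp 4 := by rw [← Real.exp_nat_mul]; norm_num
          rw [Real.exp_neg, inv_le_comm₀ (Real.exp_pos _) (by norm_num)]
          linarith
  have h0 := silenceProb_nonneg hF hv hw hw1
  have hwv := hw v hv
  nlinarith [mul_le_mul_of_nonneg_left (min_le_right ζ (2 * w v)) h0,
    mul_le_mul_of_nonneg_right h1 hwv]

/-- The mean of the inverse transmission probability of a node after the update. -/
lemma sum_inv_update_le (hP1 : ∑ ω, P ω = 1) (hζ : 0 < ζ) (hF : 1 ≤ F)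
    (hw : ∀ u ∈ A, 0 < w u) (hw1 : ∀ u ∈ A, w u ≤ 1)
    (hE : ∀ v ∈ A, ∑ ω, P ω * (if E v ω then 1 else 0) = silenceProb F A w v)
    (hv : v ∈ A) :
    ∑ ω, P ω * (if E v ω then min ζ (2 * w v) else w v / 2)⁻¹ ≤
      (min ζ (2 * w v))⁻¹ + 3 / 2 + 3 / 2 * ((∑ u ∈ A, w u) / F) * (w v)⁻¹ := by
  have hwv := hw v hv
  have hmin : 0 < min ζ (2 * w v) := lt_min hζ (by linarith)
  simp only [apply_ite (·⁻¹)]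
  rw [sum_mul_ite hP1, hE v hv]
  have h0 := silenceProb_nonneg hF hv (fun u hu => (hw u hu).le) hw1
  have h1 := le_silenceProb hF hv (fun u hu => (hw u hu).le) hw1
  have h2 : (2 * w v)⁻¹ ≤ (min ζ (2 * w v))⁻¹ := inv_anti₀ hmin (min_le_right _ _)
  have e1 : (w v / 2)⁻¹ = 2 * (w v)⁻¹ := by rw [inv_div]; ring
  have e2 : (2 * w v)⁻¹ = (w v)⁻¹ / 2 := by rw [mul_inv]; ring
  rw [e1]
  rw [e2] at h2
  have hi : 0 < (w v)⁻¹ := inv_pos.2 hwv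
  set t := silenceProb F A w v
  set Y := (∑ u ∈ A, w u) / F
  have hle : t ≤ 1 := by
    have := silenceProb_le hF hv (fun u hu => (hw u hu).le) hw1
    refine this.trans (Real.exp_le_one_iff.2 ?_)
    have : 0 ≤ ∑ u ∈ A, w u := Finset.sum_nonneg fun u hu => (hw u hu).le
    have : 0 ≤ (∑ u ∈ A, w u) / F := by positivity
    linarith
  -- Missing silence costs at most `2 (w v)⁻¹ - (w v)⁻¹ / 2 = 3/2 * (w v)⁻¹` over the capped
  -- doubling, and its chance `1 - t` is at most `w v + Y`.
  have h3 : (1 - t) * (w v)⁻¹ ≤ 1 + Y * (w v)⁻¹ := by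
    calc (1 - t) * (w v)⁻¹ ≤ (w v + Y) * (w v)⁻¹ := by gcongr; linarith
      _ = _ := by rw [add_mul, mul_inv_cancel₀ hwv.ne']
  nlinarith [mul_le_mul_of_nonneg_left h2 (by linarith : 0 ≤ 1 - t)]

end Silence

end

/-! ## The two kinds of half-rounds -/

section

lemma potential_congr {ι : Type*} {F β : ℝ} {M : ℕ} {A : Finset ι} {w w' : ι → ℝ}
    (h : ∀ v ∈ A, w v = w' v) : potential F M β A w = potential F M β A w' := by
  unfold potential
  have h' : ∑ v ∈ A, (w v)⁻¹ = ∑ v ∈ A, (w' v)⁻¹ :=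
    Finset.sum_congr rfl fun v hv => by rw [h v hv]
  rw [Finset.sum_congr rfl h, h']

/-- A step in which nodes update their probabilities according to the perceived silence, and drop
out if they alone transmit on their channel and are heard, contracts the potential. -/
lemma sum_potential_update_le {ι Ω : Type*} [DecidableEq ι] [Fintype Ω] {P : Ω → ℝ} {F ζ δ : ℝ}
    {M : ℕ} {A : Finset ι} {w : ι → ℝ} {E R : ι → Ω → Prop} [∀ v, DecidablePred (E v)]
    [∀ v, DecidablePred (R v)] (hP : ∀ ω, 0 ≤ P ω) (hP1 : ∑ ω, P ω = 1) (hF : 1 ≤ F)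
    (hM : F ≤ M + 1) (hζ : 0 < ζ) (hζ1 : ζ ≤ 1 / 2) (hw : ∀ v ∈ A, 0 < w v)
    (hwζ : ∀ v ∈ A, w v ≤ ζ)
    (hE : ∀ v ∈ A, ∑ ω, P ω * (if E v ω then 1 else 0) = silenceProb F A w v)
    (hR : ∀ v ∈ A, ∑ ω, P ω * (if R v ω then 1 else 0) =
      w v * (∏ u ∈ A.erase v, (1 - w u / F) - δ))
    (hδ : M < A.card → δ ≤ Real.exp (-10))
    (hRF : ∀ ω, ((A.filter fun v => R v ω).card : ℝ) ≤ F)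
    (hcap : M < A.card → ∑ v ∈ A, w v ≤ ζ / 100 * F →
      ∑ v ∈ A, ((min ζ (2 * w v))⁻¹ + 3 / 2) ≤ 11 / 20 * ∑ v ∈ A, (w v)⁻¹) :
    ∑ ω, P ω * potential F M (ζ / 600000 / 16) (A.filter fun v => ¬ R v ω)
        (fun v => if E v ω then min ζ (2 * w v) else w v / 2) ≤
      Real.exp (-(ζ / 600000 / 64)) * potential F M (ζ / 600000 / 16) A w := by
  have hF0 : 0 < F := by linarith
  have hw0 : ∀ v ∈ A, 0 ≤ w v := fun v hv => (hw v hv).le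
  have hw1 : ∀ v ∈ A, w v ≤ 1 := fun v hv => by linarith [hwζ v hv]
  have hcount : ∀ ω, (A.card - (A.filter fun v => ¬ R v ω).card : ℝ) =
      ∑ v ∈ A, if R v ω then (1 : ℝ) else 0 := fun ω => by
    rw [← Finset.card_filter_add_card_filter_not (s := A) (fun v => R v ω), Finset.sum_boole]
    push_cast
    ring
  -- The rate `ζ / 600000` is the lower contention threshold `ζ / 100` times the success chance `1 /
  -- 6000` shown below.
  refine sum_potential_le (a := ζ / 100) hP hP1 hF0 hM hw (fun ω => Finset.filter_subset _ _)
    (fun ω => ?_) (fun ω v hv => ?_) (fun ω v hv => ?_) (by linarith) (by positivity)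
    (by linarith) (fun _ hY => ?_) (fun hAM hY => ?_) (fun hAM hY hY4 => ?_)
  · rw [hcount, Finset.sum_boole]
    exact hRF ω
  · have := hw v hv
    split_ifs
    · exact min_le_right _ _
    · linarith
  · have := hw v hv
    split_ifs
    · exact le_min (by linarith [hwζ v hv]) (by linarith)
    · exact le_rfl
  · exact sum_update_le hP1 hF hw0 hw1 hE hY
  · simp only [Finset.mul_sum (s := A)]
    rw [Finset.sum_comm]
    have hS : 0 ≤ ∑ v ∈ A, (w v)⁻¹ := Finset.sum_nonneg fun v hv => inv_nonneg.2 (hw0 v hv)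
    -- The contention term then adds at most `3/200` to the `11/20` of `hcap`, still below `3/5`.
    have hY' : (∑ u ∈ A, w u) / F ≤ 1 / 100 := by
      rw [div_le_iff₀ hF0]
      nlinarith
    calc _ ≤ ∑ v ∈ A, ((min ζ (2 * w v))⁻¹ + 3 / 2 +
          3 / 2 * ((∑ u ∈ A, w u) / F) * (w v)⁻¹) :=
          Finset.sum_le_sum fun v hv => sum_inv_update_le hP1 hζ hF hw hw1 hE hv
      _ = ∑ v ∈ A, ((min ζ (2 * w v))⁻¹ + 3 / 2) +
          3 / 2 * ((∑ u ∈ A, w u) / F) * ∑ v ∈ A, (w v)⁻¹ := by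
          rw [Finset.sum_add_distrib, ← Finset.mul_sum]
      _ ≤ 3 / 5 * ∑ v ∈ A, (w v)⁻¹ := by
          have := hcap hAM hY
          nlinarith [mul_le_mul_of_nonneg_right hY' hS]
      _ = _ := by rw [Finset.mul_sum]
  · simp only [hcount, Finset.mul_sum]
    rw [Finset.sum_comm]
    have hY' : (∑ u ∈ A, w u) / F ≤ 4 := by rwa [div_le_iff₀ hF0]
    -- For `Y ≤ 4` no other node transmits on a given channel with chance at least `exp (-8)`; `δ ≤
    -- exp (-10)` accounts for a sender that nobody hears.
    have hgap : (1 : ℝ) / 6000 ≤ Real.exp (-8) - Real.exp (-10) := by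
      have h2 : 2 * Real.exp (-10) ≤ Real.exp (-8) := by
        have : Real.exp (-8) = Real.exp 2 * Real.exp (-10) := by
          rw [← Real.exp_add]; norm_num
        rw [this]
        gcongr
        linarith [Real.add_one_le_exp (2 : ℝ)]
      have h8 : (1 : ℝ) / 3000 ≤ Real.exp (-8) := by
        have : Real.exp 8 ≤ 3000 := by
          have := Real.exp_one_lt_d9
          calc Real.exp 8 = Real.exp 1 ^ 8 := by rw [← Real.exp_nat_mul]; norm_num
            _ ≤ 2.7182818286 ^ 8 := by gcongr
            _ ≤ 3000 := by norm_num
        rw [Real.exp_neg, one_div]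
        exact inv_anti₀ (Real.exp_pos _) this
      linarith
    calc ζ / 600000 * F ≤ 1 / 6000 * ∑ v ∈ A, w v := by linarith
      _ = ∑ v ∈ A, w v * (1 / 6000) := by rw [← Finset.sum_mul, mul_comm]
      _ ≤ _ := Finset.sum_le_sum fun v hv => by
          rw [hR v hv]
          refine mul_le_mul_of_nonneg_left ?_ (hw0 v hv)
          have h1 := exp_le_prod_erase (v := v) hF hw0 fun u hu => (hwζ u hu).trans hζ1
          have h2 : Real.exp (-8) ≤ Real.exp (-(2 * ((∑ u ∈ A, w u) / F))) := by
            gcongr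
            linarith
          linarith [hδ hAM]

variable {n F : ℕ}

open Classical in
lemma coe_newProb (ζ w : ℝ≥0) (o : Observation n) :
    ((newProb ζ w o : ℝ≥0) : ℝ) = if o = .silence then min (ζ : ℝ) (2 * w) else w / 2 := by
  cases o <;> simp [newProb]

/-- Hence at most one node per channel drops out, which keeps the normalised progress `D` at most
`1`. -/
lemma acknowledged_injOn {a : Fin n → Action n F} {u v : Fin n} {c : Fin F}
    {m m' : Finset (Fin n)} (hu : Acknowledged a u) (hua : a u = .transmit c m)
    (hva : a v = .transmit c m') : u = v := by
  obtain ⟨d, m'', h1, h2, -⟩ := acknowledged_iff.1 hu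
  rw [hua] at h1
  obtain ⟨rfl, -⟩ := Action.transmit.inj h1
  have : v ∈ transmitters a c := mem_transmitters.2 ⟨_, hva⟩
  rw [h2] at this
  exact (Finset.mem_singleton.1 this).symm

lemma Acknowledged.exists_transmit {a : Fin n → Action n F} {v : Fin n} (h : Acknowledged a v) :
    ∃ c m, a v = .transmit c m := by
  obtain ⟨c, m, h1, -⟩ := acknowledged_iff.1 h
  exact ⟨c, m, h1⟩

/-- Brings a conjunction of conditions on distinct nodes into the form to which
`sum_prod_weights_mul` applies. -/
lemma ite_eq_mul_prod {ι : Type*} {s : Finset ι} {p : ι → Prop} {q Q : Prop} [DecidablePred p]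
    [Decidable q] [Decidable Q] (h : Q ↔ q ∧ ∀ i ∈ s, p i) :
    (if Q then (1 : ℝ) else 0) = (if q then 1 else 0) * ∏ i ∈ s, if p i then (1 : ℝ) else 0 := by
  rw [Finset.prod_boole, if_congr h rfl rfl]
  split_ifs <;> simp_all

/-! ### The multi-channel half-round -/

/-- The weight of a choice of channel and coin. -/
noncomputable def choiceWeight (F : ℕ) (w : ℝ) (r : Fin F × Bool) : ℝ :=
  (if r.2 then w else 1 - w) / F

lemma sum_choiceWeight_mul [NeZero F] (w : ℝ) (φ : Fin F × Bool → ℝ) :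
    ∑ r, choiceWeight F w r * φ r =
      (∑ c, (w * φ (c, true) + (1 - w) * φ (c, false))) / F := by
  rw [Fintype.sum_prod_type, Finset.sum_div]
  refine Finset.sum_congr rfl fun c _ => ?_
  simp [choiceWeight]
  ring

lemma sum_choiceWeight [NeZero F] (w : ℝ) : ∑ r, choiceWeight F w r = 1 := by
  have := sum_choiceWeight_mul (F := F) w fun _ => 1
  have hF : (F : ℝ) ≠ 0 := Nat.cast_ne_zero.2 (NeZero.ne F)
  simpa [hF] using this

lemma sum_choiceWeight_true [NeZero F] (w : ℝ) (c : Fin F) :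
    ∑ a, choiceWeight F w a * (if a = (c, true) then (1 : ℝ) else 0) = w / F := by
  simp [choiceWeight]

lemma sum_choiceWeight_false [NeZero F] (w : ℝ) (c : Fin F) :
    ∑ a, choiceWeight F w a * (if a = (c, false) then (1 : ℝ) else 0) = (1 - w) / F := by
  simp [choiceWeight]

lemma sum_choiceWeight_ne_true [NeZero F] (w : ℝ) (c : Fin F) :
    ∑ a, choiceWeight F w a * (if a ≠ (c, true) then (1 : ℝ) else 0) = 1 - w / F := by
  have : ∀ a, choiceWeight F w a * (if a ≠ (c, true) then (1 : ℝ) else 0) =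
      choiceWeight F w a - choiceWeight F w a * (if a = (c, true) then (1 : ℝ) else 0) :=
    fun a => by by_cases h : a = (c, true) <;> simp [h]
  simp only [this, Finset.sum_sub_distrib, sum_choiceWeight, sum_choiceWeight_true]

lemma sum_choiceWeight_fst_ne [NeZero F] (w : ℝ) (c : Fin F) :
    ∑ a, choiceWeight F w a * (if a.1 ≠ c then (1 : ℝ) else 0) = 1 - 1 / F := by
  have : ∀ a : Fin F × Bool, choiceWeight F w a * (if a.1 ≠ c then (1 : ℝ) else 0) =
      choiceWeight F w a - (choiceWeight F w a * (if a = (c, true) then (1 : ℝ) else 0) +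
        choiceWeight F w a * (if a = (c, false) then (1 : ℝ) else 0)) := by
    rintro ⟨d, b⟩
    by_cases h : d = c <;> cases b <;> simp [h]
  simp only [this, Finset.sum_sub_distrib, Finset.sum_add_distrib, sum_choiceWeight,
    sum_choiceWeight_true, sum_choiceWeight_false]
  ring

section Multi

variable {x : Config n} {r : Fin n → Fin F × Bool} {v : Fin n}

lemma observe_multi_eq_silence (hv : v ∈ x.active) :
    observe (multiActions x r) v = .silence ↔
      (r v).2 = false ∧ ∀ u ∈ x.active.erase v, r u ≠ ((r v).1, true) := by
  rw [observe_eq_silence]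
  constructor
  · rintro ⟨c, h1, h2⟩
    obtain ⟨-, h3, rfl⟩ := multiActions_eq_listen.1 h1
    refine ⟨h3, fun u hu h => ?_⟩
    have : u ∈ transmitters (multiActions x r) (r v).1 := mem_transmitters.2
      ⟨_, multiActions_eq_transmit.2 ⟨Finset.mem_of_mem_erase hu, by rw [h], by rw [h], rfl⟩⟩
    simp [h2] at this
  · rintro ⟨h1, h2⟩
    refine ⟨_, multiActions_eq_listen.2 ⟨hv, h1, rfl⟩, Finset.eq_empty_iff_forall_notMem.2 ?_⟩
    intro u hu
    obtain ⟨m, hu⟩ := mem_transmitters.1 hu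
    obtain ⟨ha, h3, h4, -⟩ := multiActions_eq_transmit.1 hu
    refine h2 u (Finset.mem_erase.2 ⟨?_, ha⟩) (Prod.ext h4 h3)
    rintro rfl
    simp [h1] at h3

/-- Once no other node transmits on the channel of `v`, having a listener means that some other
active node chose that channel. The event is thus a difference of two events that are products over
nodes once the channel of `v` is fixed. -/
lemma acknowledged_multi (hv : v ∈ x.active) :
    Acknowledged (multiActions x r) v ↔
      (r v).2 = true ∧ (∀ u ∈ x.active.erase v, r u ≠ ((r v).1, true)) ∧
        ¬ ∀ u ∈ x.active.erase v, (r u).1 ≠ (r v).1 := by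
  rw [acknowledged_iff]
  constructor
  · rintro ⟨c, m, h1, h2, w, hw⟩
    obtain ⟨-, h3, rfl, -⟩ := multiActions_eq_transmit.1 h1
    obtain ⟨hwa, hw2, hw1⟩ := multiActions_eq_listen.1 hw
    refine ⟨h3, fun u hu h => ?_, fun h => h w (Finset.mem_erase.2 ⟨?_, hwa⟩) hw1⟩
    · have : u ∈ transmitters (multiActions x r) (r v).1 := mem_transmitters.2
        ⟨_, multiActions_eq_transmit.2 ⟨Finset.mem_of_mem_erase hu, by rw [h], by rw [h], rfl⟩⟩
      rw [h2, Finset.mem_singleton] at this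
      exact (Finset.mem_erase.1 hu).1 this
    · rintro rfl
      simp [h3] at hw2
  · rintro ⟨h1, h2, h3⟩
    push Not at h3
    obtain ⟨w, hw, hwc⟩ := h3
    refine ⟨_, _, multiActions_eq_transmit.2 ⟨hv, h1, rfl, rfl⟩, ?_, w,
      multiActions_eq_listen.2 ⟨Finset.mem_of_mem_erase hw, ?_, hwc⟩⟩
    · ext u
      rw [mem_transmitters, Finset.mem_singleton]
      constructor
      · rintro ⟨m, hu⟩
        obtain ⟨ha, h4, h5, -⟩ := multiActions_eq_transmit.1 hu
        by_contra hne
        exact h2 u (Finset.mem_erase.2 ⟨hne, ha⟩) (Prod.ext h5 h4)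
      · rintro rfl
        exact ⟨_, multiActions_eq_transmit.2 ⟨hv, h1, rfl, rfl⟩⟩
    · have := h2 w hw
      by_contra h
      exact this (Prod.ext hwc (by simpa using h))

/-- Splits by the channel of `v`; with that channel fixed, the remaining conditions concern distinct
nodes and are independent. -/
lemma sum_ite_eq_fst (v : Fin n) (b : Bool) (f : Fin F → ℝ) :
    ∑ c, (if r v = (c, b) then 1 else 0) * f c = if (r v).2 = b then f (r v).1 else 0 := by
  simp only [Prod.ext_iff, ite_and, ite_mul, one_mul, zero_mul]
  rw [Finset.sum_ite_eq]
  simp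

open Classical in
lemma sum_silence_multi [NeZero F] (w : Fin n → ℝ) (hv : v ∈ x.active) :
    ∑ r : Fin n → Fin F × Bool, (∏ i, choiceWeight F (w i) (r i)) *
        (if observe (multiActions x r) v = .silence then 1 else 0) =
      silenceProb F x.active w v := by
  have hF : (F : ℝ) ≠ 0 := Nat.cast_ne_zero.2 (NeZero.ne F)
  have hind : ∀ r : Fin n → Fin F × Bool,
      (if observe (multiActions x r) v = .silence then (1 : ℝ) else 0) =
      ∑ c, (if r v = (c, false) then 1 else 0) *
        ∏ u ∈ x.active.erase v, if r u ≠ (c, true) then (1 : ℝ) else 0 := fun r => by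
    rw [sum_ite_eq_fst, ite_eq_mul_prod (observe_multi_eq_silence hv), ite_mul, one_mul, zero_mul]
  have hE : ∀ c : Fin F, ∑ r : Fin n → Fin F × Bool, (∏ i, choiceWeight F (w i) (r i)) *
      ((if r v = (c, false) then 1 else 0) *
        ∏ u ∈ x.active.erase v, if r u ≠ (c, true) then (1 : ℝ) else 0) =
      (1 - w v) / F * ∏ u ∈ x.active.erase v, (1 - w u / F) := fun c => by
    have := sum_prod_weights_mul (fun i => sum_choiceWeight (F := F) (w i))
      (Finset.notMem_erase v x.active) (fun a => if a = (c, false) then (1 : ℝ) else 0)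
      (fun _ a => if a ≠ (c, true) then (1 : ℝ) else 0)
    simpa only [sum_choiceWeight_false, sum_choiceWeight_ne_true] using this
  simp only [hind, Finset.mul_sum]
  rw [Finset.sum_comm]
  simp only [hE]
  rw [Finset.sum_const, Finset.card_univ, Fintype.card_fin, nsmul_eq_mul, silenceProb]
  field_simp

open Classical in
-- The product is the chance that no other active node transmits on the channel of `v`; the
-- subtracted power is the chance that no other active node is on it at all.
lemma sum_acknowledged_multi [NeZero F] (w : Fin n → ℝ) (hv : v ∈ x.active) :
    ∑ r : Fin n → Fin F × Bool, (∏ i, choiceWeight F (w i) (r i)) *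
        (if Acknowledged (multiActions x r) v then 1 else 0) =
      w v * (∏ u ∈ x.active.erase v, (1 - w u / F) - (1 - 1 / F) ^ (x.active.card - 1)) := by
  have hF : (F : ℝ) ≠ 0 := Nat.cast_ne_zero.2 (NeZero.ne F)
  have hind : ∀ r : Fin n → Fin F × Bool,
      (if Acknowledged (multiActions x r) v then (1 : ℝ) else 0) =
      ∑ c, ((if r v = (c, true) then 1 else 0) *
          (∏ u ∈ x.active.erase v, if r u ≠ (c, true) then (1 : ℝ) else 0) -
        (if r v = (c, true) then 1 else 0) *
          ∏ u ∈ x.active.erase v, if (r u).1 ≠ c then (1 : ℝ) else 0) := fun r => by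
    rw [Finset.sum_sub_distrib, sum_ite_eq_fst, sum_ite_eq_fst, Finset.prod_boole,
      Finset.prod_boole, acknowledged_multi hv]
    by_cases h1 : (r v).2 = true
    · by_cases h2 : ∀ u ∈ x.active.erase v, (r u).1 ≠ (r v).1
      · have h3 : ∀ u ∈ x.active.erase v, r u ≠ ((r v).1, true) := fun u hu h =>
          h2 u hu (by rw [h])
        rw [if_neg (fun h => h.2.2 h2), if_pos h1, if_pos h3, if_pos h1, if_pos h2, sub_self]
      · by_cases h3 : ∀ u ∈ x.active.erase v, r u ≠ ((r v).1, true)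
        · rw [if_pos ⟨h1, h3, h2⟩, if_pos h1, if_pos h3, if_pos h1, if_neg h2, sub_zero]
        · rw [if_neg (fun h => h3 h.2.1), if_pos h1, if_neg h3, if_pos h1, if_neg h2, sub_zero]
    · simp [h1]
  have hE : ∀ c : Fin F, ∑ r : Fin n → Fin F × Bool, (∏ i, choiceWeight F (w i) (r i)) *
      ((if r v = (c, true) then 1 else 0) *
        ∏ u ∈ x.active.erase v, if r u ≠ (c, true) then (1 : ℝ) else 0) =
      w v / F * ∏ u ∈ x.active.erase v, (1 - w u / F) := fun c => by
    have := sum_prod_weights_mul (fun i => sum_choiceWeight (F := F) (w i))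
      (Finset.notMem_erase v x.active) (fun a => if a = (c, true) then (1 : ℝ) else 0)
      (fun _ a => if a ≠ (c, true) then (1 : ℝ) else 0)
    simpa only [sum_choiceWeight_true, sum_choiceWeight_ne_true] using this
  have hE' : ∀ c : Fin F, ∑ r : Fin n → Fin F × Bool, (∏ i, choiceWeight F (w i) (r i)) *
      ((if r v = (c, true) then 1 else 0) *
        ∏ u ∈ x.active.erase v, if (r u).1 ≠ c then (1 : ℝ) else 0) =
      w v / F * ∏ u ∈ x.active.erase v, (1 - 1 / (F : ℝ)) := fun c => by
    have := sum_prod_weights_mul (fun i => sum_choiceWeight (F := F) (w i))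
      (Finset.notMem_erase v x.active) (fun a => if a = (c, true) then (1 : ℝ) else 0)
      (fun _ a => if a.1 ≠ c then (1 : ℝ) else 0)
    simpa only [sum_choiceWeight_true, sum_choiceWeight_fst_ne] using this
  simp only [hind, Finset.mul_sum, mul_sub]
  rw [Finset.sum_comm]
  simp only [Finset.sum_sub_distrib, hE, hE']
  rw [Finset.sum_const, Finset.sum_const, Finset.prod_const, Finset.card_erase_of_mem hv,
    Finset.card_univ, Fintype.card_fin, nsmul_eq_mul, nsmul_eq_mul]
  field_simp

open Classical in
lemma sum_potential_multi_le [NeZero F] {ζ : ℝ≥0} (hζ : 0 < ζ) (hζ1 : ζ ≤ 1 / 2)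
    (hp : ∀ v, 0 < x.p v) (hpζ : ∀ v, x.p v ≤ ζ) :
    ∑ r : Fin n → Fin F × Bool, (∏ i, choiceWeight F (x.p i) (r i)) *
        potential F (10 * F) (ζ / 600000 / 16) (afterMulti ζ x r).active
          (fun v => ((afterMulti ζ x r).p v : ℝ)) ≤
      Real.exp (-(ζ / 600000 / 64)) *
        potential F (10 * F) (ζ / 600000 / 16) x.active (fun v => (x.p v : ℝ)) := by
  have hF1 : (1 : ℝ) ≤ F := by exact_mod_cast NeZero.one_le
  have hF0 : (0 : ℝ) < F := by linarith
  have hζ' : (0 : ℝ) < ζ := by exact_mod_cast hζ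
  have hζ1' : (ζ : ℝ) ≤ 1 / 2 := by exact_mod_cast hζ1
  have hp' : ∀ v, (0 : ℝ) < x.p v := fun v => by exact_mod_cast hp v
  have hpζ' : ∀ v, (x.p v : ℝ) ≤ ζ := fun v => by exact_mod_cast hpζ v
  have main := sum_potential_update_le (M := 10 * F) (A := x.active)
    (P := fun r : Fin n → Fin F × Bool => ∏ i, choiceWeight F (x.p i) (r i))
    (w := fun v => (x.p v : ℝ)) (E := fun v r => observe (multiActions x r) v = .silence)
    (R := fun v r => Acknowledged (multiActions x r) v)
    (δ := (1 - 1 / F) ^ (x.active.card - 1))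
    (fun r => Finset.prod_nonneg fun i _ => by
      have := hpζ' i
      have := hp' i
      unfold choiceWeight
      split_ifs
      · positivity
      · exact div_nonneg (by linarith) hF0.le)
    (sum_prod_weights fun i => sum_choiceWeight _) hF1 (by push_cast; linarith) hζ' hζ1'
    (fun v _ => hp' v) (fun v _ => hpζ' v) (fun v hv => sum_silence_multi _ hv)
    (fun v hv => sum_acknowledged_multi _ hv)
    -- At least `10F` other active nodes leave the channel of `v` without company with chance at
    -- most `exp (-10)`.
    (fun hAM => by
      have h0 : (0 : ℝ) ≤ 1 - 1 / F := by
        rw [sub_nonneg, div_le_one hF0]; exact hF1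
      have hm : 10 * (F : ℝ) ≤ (x.active.card - 1 : ℕ) := by
        exact_mod_cast (by omega : 10 * F ≤ x.active.card - 1)
      calc (1 - 1 / (F : ℝ)) ^ (x.active.card - 1) ≤
            Real.exp (-(1 / F)) ^ (x.active.card - 1) := by
            gcongr
            linarith [Real.add_one_le_exp (-(1 / F : ℝ))]
        _ = Real.exp (-((x.active.card - 1 : ℕ) / F)) := by
            rw [← Real.exp_nat_mul]; congr 1; ring
        _ ≤ _ := by
            gcongr
            rwa [le_div_iff₀ hF0])
    (fun r => by
      have : (x.active.filter fun v => Acknowledged (multiActions x r) v).card ≤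
          (Finset.univ : Finset (Fin F)).card := by
        refine Finset.card_le_card_of_injOn (fun v => (r v).1) (fun _ _ => Finset.mem_univ _) ?_
        intro u hu v hv huv
        simp only [Finset.coe_filter, Set.mem_ofPred_eq] at hu hv
        obtain ⟨c, m, h1⟩ := hu.2.exists_transmit
        obtain ⟨c', m', h2⟩ := hv.2.exists_transmit
        have e1 := (multiActions_eq_transmit.1 h1).2.2.1
        have e2 := (multiActions_eq_transmit.1 h2).2.2.1
        have : c' = c := by rw [← e1, ← e2]; exact huv.symm
        subst this
        exact acknowledged_injOn hu.2 h1 h2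
      rw [Finset.card_univ, Fintype.card_fin] at this
      exact_mod_cast this)
    -- The inverse of a node at the cap `ζ` need not halve. But `m ≥ 10F` and `m² ≤ (∑ p) * S` with
    -- small `∑ p` give `1000 m ≤ ζ S`, so the terms `ζ⁻¹` and `3/2` together fit into `S / 20`.
    (fun hAM hY => by
      have hm : 10 * (F : ℝ) ≤ x.active.card := by exact_mod_cast hAM.le
      have hm0 : (0 : ℝ) < x.active.card := by linarith
      have hcs := sq_card_le_sum_mul_sum_inv (A := x.active) (w := fun v => (x.p v : ℝ))
        (fun v _ => hp' v)
      set S := ∑ v ∈ x.active, (x.p v : ℝ)⁻¹ with hS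
      have hS0 : 0 ≤ S := Finset.sum_nonneg fun v _ => (inv_pos.2 (hp' v)).le
      have hmS : 1000 * (x.active.card : ℝ) ≤ ζ * S := by
        have h1 : (x.active.card : ℝ) ^ 2 ≤ ζ / 100 * F * S :=
          hcs.trans (mul_le_mul_of_nonneg_right hY hS0)
        have h2 : 10 * F * (x.active.card : ℝ) ≤ ζ / 100 * F * S := by nlinarith
        have h3 : F * (1000 * (x.active.card : ℝ)) ≤ F * (ζ * S) := by linarith
        exact le_of_mul_le_mul_left h3 hF0
      have hi : (x.active.card : ℝ) * (ζ : ℝ)⁻¹ ≤ S / 1000 := by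
        rw [← div_eq_mul_inv, div_le_iff₀ hζ']
        linarith
      calc _ ≤ ∑ v ∈ x.active, ((ζ : ℝ)⁻¹ + (x.p v : ℝ)⁻¹ / 2 + 3 / 2) := by
            gcongr with v _
            have h0 := inv_pos.2 hζ'
            have h1 := inv_pos.2 (hp' v)
            rcases min_choice (ζ : ℝ) (2 * x.p v) with h | h <;> rw [h]
            · linarith
            · rw [mul_inv]; linarith
        _ = x.active.card * (ζ : ℝ)⁻¹ + S / 2 + x.active.card * (3 / 2) := by
            rw [Finset.sum_add_distrib, Finset.sum_add_distrib, Finset.sum_const, Finset.sum_const,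
              nsmul_eq_mul, nsmul_eq_mul, ← Finset.sum_div]
        _ ≤ _ := by nlinarith)
  convert main using 3 with r
  have hact : (afterMulti ζ x r).active =
      x.active.filter fun v => ¬ Acknowledged (multiActions x r) v := by
    ext v; simp [afterMulti]
  rw [hact]
  exact potential_congr fun v hv => by
    simp [afterMulti, (Finset.mem_filter.1 hv).1, coe_newProb]

end Multi

end

section

variable {n F : ℕ}

/-! ### The primary half-round -/

/-- The weight of a coin. -/
noncomputable def coinWeight (w : ℝ) (b : Bool) : ℝ := if b then w else 1 - w

lemma sum_coinWeight (w : ℝ) : ∑ b, coinWeight w b = 1 := by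
  simp [coinWeight]

section Primary

variable {x : Config n} {b : Fin n → Bool} {v : Fin n} [NeZero F]

lemma observe_primary_eq_silence (hv : v ∈ x.active) :
    observe (primaryActions x b : Fin n → Action n F) v = .silence ↔
      b v = false ∧ ∀ u ∈ x.active.erase v, b u = false := by
  rw [observe_eq_silence]
  constructor
  · rintro ⟨c, h1, h2⟩
    have key : ∀ u ∈ x.active, b u = false := fun u hu => by
      by_contra h
      obtain ⟨-, rfl⟩ := primaryActions_eq_listen.1 h1
      have : u ∈ transmitters (primaryActions x b : Fin n → Action n F) 0 := mem_transmitters.2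
        ⟨_, primaryActions_eq_transmit.2 ⟨hu, by simpa using h, rfl, rfl⟩⟩
      simp [h2] at this
    exact ⟨key v hv, fun u hu => key u (Finset.mem_of_mem_erase hu)⟩
  · rintro ⟨h1, h2⟩
    refine ⟨0, primaryActions_eq_listen.2 ⟨by simp [h1], rfl⟩,
      Finset.eq_empty_iff_forall_notMem.2 fun u hu => ?_⟩
    obtain ⟨m, hu⟩ := mem_transmitters.1 hu
    obtain ⟨ha, h3, -⟩ := primaryActions_eq_transmit.1 hu
    by_cases huv : u = v
    · subst huv; simp [h1] at h3
    · simp [h2 u (Finset.mem_erase.2 ⟨huv, ha⟩)] at h3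

/-- Every other node listens to the primary channel if it does not transmit, active or not, so a
second node in the network is enough for the acknowledgement. -/
lemma acknowledged_primary (hn : 2 ≤ n) (hv : v ∈ x.active) :
    Acknowledged (primaryActions x b : Fin n → Action n F) v ↔
      b v = true ∧ ∀ u ∈ x.active.erase v, b u = false := by
  rw [acknowledged_iff]
  constructor
  · rintro ⟨c, m, h1, h2, -⟩
    obtain ⟨-, h3, rfl, -⟩ := primaryActions_eq_transmit.1 h1
    refine ⟨h3, fun u hu => ?_⟩
    by_contra h
    have : u ∈ transmitters (primaryActions x b : Fin n → Action n F) 0 := mem_transmitters.2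
      ⟨_, primaryActions_eq_transmit.2 ⟨Finset.mem_of_mem_erase hu, by simpa using h, rfl, rfl⟩⟩
    rw [h2, Finset.mem_singleton] at this
    exact (Finset.mem_erase.1 hu).1 this
  · rintro ⟨h1, h2⟩
    have hother : ∀ u, u ≠ v → ¬ (u ∈ x.active ∧ b u = true) := fun u huv h => by
      simp [h2 u (Finset.mem_erase.2 ⟨huv, h.1⟩)] at h
    have hnt : Nontrivial (Fin n) := Fin.nontrivial_iff_two_le.2 hn
    obtain ⟨w, hw⟩ := exists_ne v
    refine ⟨0, _, primaryActions_eq_transmit.2 ⟨hv, h1, rfl, rfl⟩, ?_, w,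
      primaryActions_eq_listen.2 ⟨hother w hw, rfl⟩⟩
    ext u
    rw [mem_transmitters, Finset.mem_singleton]
    constructor
    · rintro ⟨m, hu⟩
      obtain ⟨ha, h4, -⟩ := primaryActions_eq_transmit.1 hu
      by_contra hne
      exact hother u hne ⟨ha, h4⟩
    · rintro rfl
      exact ⟨_, primaryActions_eq_transmit.2 ⟨hv, h1, rfl, rfl⟩⟩

/-- Covers silence (`e = false`) and success (`e = true`) together; the division by `1` matches
`silenceProb` for a single channel. -/
lemma sum_coins_mul (w : Fin n → ℝ) (A : Finset (Fin n)) (v : Fin n) (e : Bool)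
    (E : (Fin n → Bool) → Prop) [DecidablePred E]
    (hE : ∀ b, E b ↔ b v = e ∧ ∀ u ∈ A.erase v, b u = false) :
    ∑ b : Fin n → Bool, (∏ i, coinWeight (w i) (b i)) * (if E b then 1 else 0) =
      coinWeight (w v) e * ∏ u ∈ A.erase v, (1 - w u / (1 : ℝ)) := by
  have hind : ∀ b : Fin n → Bool, (if E b then (1 : ℝ) else 0) =
      (if b v = e then 1 else 0) * ∏ u ∈ A.erase v, if b u = false then (1 : ℝ) else 0 :=
    fun b => ite_eq_mul_prod (hE b)
  have := sum_prod_weights_mul (fun i => sum_coinWeight (w i)) (Finset.notMem_erase v A)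
    (fun a => if a = e then (1 : ℝ) else 0) (fun _ a => if a = false then (1 : ℝ) else 0)
  simp only [hind, this]
  simp [coinWeight]

open Classical in
lemma sum_potential_primary_le {ζ : ℝ≥0} (hn : 2 ≤ n) (hζ : 0 < ζ) (hζ1 : ζ ≤ 1 / 2)
    (hq : ∀ v, 0 < x.q v) (hqζ : ∀ v, x.q v ≤ ζ) :
    ∑ b : Fin n → Bool, (∏ i, coinWeight (x.q i) (b i)) *
        potential 1 0 (ζ / 600000 / 16) (afterPrimary F ζ x b).active
          (fun v => ((afterPrimary F ζ x b).q v : ℝ)) ≤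
      Real.exp (-(ζ / 600000 / 64)) *
        potential 1 0 (ζ / 600000 / 16) x.active (fun v => (x.q v : ℝ)) := by
  have hζ' : (0 : ℝ) < ζ := by exact_mod_cast hζ
  have hζ1' : (ζ : ℝ) ≤ 1 / 2 := by exact_mod_cast hζ1
  have hq' : ∀ v, (0 : ℝ) < x.q v := fun v => by exact_mod_cast hq v
  have hqζ' : ∀ v, (x.q v : ℝ) ≤ ζ := fun v => by exact_mod_cast hqζ v
  have main := sum_potential_update_le (M := 0) (A := x.active) (F := 1) (ζ := ζ)
    (P := fun b : Fin n → Bool => ∏ i, coinWeight (x.q i) (b i))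
    (w := fun v => (x.q v : ℝ))
    (E := fun v b => observe (primaryActions x b : Fin n → Action n F) v = .silence)
    (R := fun v b => Acknowledged (primaryActions x b : Fin n → Action n F) v) (δ := 0)
    (fun b => Finset.prod_nonneg fun i _ => by
      have := hqζ' i
      have := hq' i
      unfold coinWeight
      split_ifs <;> linarith)
    (sum_prod_weights fun i => sum_coinWeight _) le_rfl (by simp) hζ' hζ1'
    (fun v _ => hq' v) (fun v _ => hqζ' v)
    (fun v hv => by
      rw [sum_coins_mul _ x.active v false _ fun b => observe_primary_eq_silence hv]
      simp [coinWeight, silenceProb])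
    (fun v hv => by
      rw [sum_coins_mul _ x.active v true _ fun b => acknowledged_primary hn hv]
      simp [coinWeight])
    (fun _ => (Real.exp_pos _).le)
    (fun b => by
      have : (x.active.filter fun v =>
          Acknowledged (primaryActions x b : Fin n → Action n F) v).card ≤ 1 := by
        refine Finset.card_le_one.2 fun u hu v hv => ?_
        rw [Finset.mem_filter] at hu hv
        obtain ⟨c, m, h1⟩ := hu.2.exists_transmit
        obtain ⟨c', m', h2⟩ := hv.2.exists_transmit
        obtain ⟨-, -, rfl, -⟩ := primaryActions_eq_transmit.1 h1
        obtain ⟨-, -, rfl, -⟩ := primaryActions_eq_transmit.1 h2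
        exact acknowledged_injOn hu.2 h1 h2
      exact_mod_cast this)
    -- On one channel a small sum bounds every `q` by `ζ / 100`, so the cap does not interfere and
    -- silence exactly halves each inverse.
    (fun _ hY => by
      rw [Finset.mul_sum]
      refine Finset.sum_le_sum fun v hv => ?_
      have h1 : (x.q v : ℝ) ≤ ζ / 100 * 1 :=
        (Finset.single_le_sum (f := fun v => (x.q v : ℝ)) (fun u _ => (hq' u).le) hv).trans hY
      have h2 : (3 : ℝ) / 2 ≤ 1 / 20 * (x.q v : ℝ)⁻¹ := by
        have : (30 : ℝ) ≤ (x.q v : ℝ)⁻¹ := by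
          rw [le_inv_comm₀ (by norm_num) (hq' v)]
          linarith
        linarith
      rw [min_eq_right (by linarith), mul_inv]
      linarith)
  convert main using 3 with b
  have hact : (afterPrimary F ζ x b).active = x.active.filter fun v =>
      ¬ Acknowledged (primaryActions x b : Fin n → Action n F) v := by
    ext v; simp [afterPrimary]
  rw [hact]
  exact potential_congr fun v hv => by
    simp [afterPrimary, (Finset.mem_filter.1 hv).1, coe_newProb]

end Primary

/-! ## Means under discrete laws -/

/-- The mean of a function under a discrete law. -/
noncomputable def mean {α : Type*} (μ : PMF α) (f : α → ℝ≥0∞) : ℝ≥0∞ := ∑' a, μ a * f a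

section Mean

variable {α β : Type*}

lemma mean_pure (a : α) (f : α → ℝ≥0∞) : mean (PMF.pure a) f = f a := by
  unfold mean
  rw [tsum_eq_single a fun b hb => by simp [PMF.pure_apply_of_ne _ _ hb]]
  simp

lemma mean_bind (μ : PMF α) (κ : α → PMF β) (f : β → ℝ≥0∞) :
    mean (μ.bind κ) f = mean μ fun a => mean (κ a) f := by
  simp only [mean, PMF.bind_apply, ← ENNReal.tsum_mul_right, ← ENNReal.tsum_mul_left, mul_assoc]
  exact ENNReal.tsum_comm

lemma mean_map (μ : PMF α) (g : α → β) (f : β → ℝ≥0∞) :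
    mean (μ.map g) f = mean μ fun a => f (g a) := by
  rw [← PMF.bind_pure_comp, mean_bind]
  simp [mean_pure]

lemma mean_mono {μ : PMF α} {f g : α → ℝ≥0∞} (h : ∀ a ∈ μ.support, f a ≤ g a) :
    mean μ f ≤ mean μ g := by
  refine ENNReal.tsum_le_tsum fun a => ?_
  by_cases ha : a ∈ μ.support
  · gcongr
    exact h a ha
  · simp [(μ.apply_eq_zero_iff a).2 ha]

lemma mean_const (μ : PMF α) (c : ℝ≥0∞) : mean μ (fun _ => c) = c := by
  simp [mean, ENNReal.tsum_mul_right, μ.tsum_coe]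

lemma mean_add (μ : PMF α) (f g : α → ℝ≥0∞) :
    mean μ (fun a => f a + g a) = mean μ f + mean μ g := by
  simp [mean, mul_add, ENNReal.tsum_add]

lemma mean_const_mul (μ : PMF α) (c : ℝ≥0∞) (f : α → ℝ≥0∞) :
    mean μ (fun a => c * f a) = c * mean μ f := by
  simp only [mean, ← ENNReal.tsum_mul_left, mul_left_comm]

lemma mean_indicator (μ : PMF α) (s : Set α) : mean μ (s.indicator 1) = μ.toOuterMeasure s := by
  rw [PMF.toOuterMeasure_apply]
  refine tsum_congr fun a => ?_
  by_cases ha : a ∈ s <;> simp [ha]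

/-- An event that contains all outcomes outside `s` is likely if `s` is unlikely. -/
lemma one_sub_le_prob {μ : PMF α} {s t : Set α} (h : ∀ a ∈ μ.support, a ∉ s → a ∈ t) {ε : ℝ}
    (hε : 0 ≤ ε) (hs : mean μ (s.indicator 1) ≤ ENNReal.ofReal ε) : 1 - ε ≤ prob μ t := by
  have h1 : 1 ≤ mean μ (s.indicator 1) + mean μ (t.indicator 1) := by
    rw [← mean_add]
    calc (1 : ℝ≥0∞) = mean μ fun _ => 1 := (mean_const μ 1).symm
      _ ≤ _ := mean_mono fun a ha => by
        by_cases has : a ∈ s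
        · simp [has]
        · simp [h a ha has]
  rw [mean_indicator μ t] at h1
  have hfin : μ.toOuterMeasure t ≠ ∞ := by
    rw [PMF.toOuterMeasure_apply]
    exact μ.tsum_coe_indicator_ne_top t
  have h2 := h1.trans (add_le_add_left hs _)
  rw [← ENNReal.ofReal_toReal hfin, ← ENNReal.ofReal_add hε ENNReal.toReal_nonneg,
    ENNReal.one_le_ofReal] at h2
  unfold prob
  linarith

lemma indep_apply {ι : Type*} [Fintype ι] [DecidableEq ι] [Fintype α] (μ : ι → PMF α)
    (ω : ι → α) : indep μ ω = ∏ i, μ i (ω i) := rfl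

/-- Transfers the finite real sums estimated above to means under the protocol's laws. -/
lemma mean_indep_map_le {ι : Type*} [Fintype ι] [DecidableEq ι] [Fintype α] {μ : ι → PMF α}
    {g : (ι → α) → β} {f : β → ℝ} {w : ι → α → ℝ} {c : ℝ}
    (hw : ∀ i a, μ i a = ENNReal.ofReal (w i a)) (hw0 : ∀ i a, 0 ≤ w i a)
    (hf : ∀ ω, 0 ≤ f (g ω)) (h : ∑ ω, (∏ i, w i (ω i)) * f (g ω) ≤ c) :
    mean ((indep μ).map g) (fun b => ENNReal.ofReal (f b)) ≤ ENNReal.ofReal c := by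
  rw [mean_map, mean, tsum_fintype]
  refine le_trans (le_of_eq ?_) (ENNReal.ofReal_le_ofReal h)
  rw [ENNReal.ofReal_sum_of_nonneg fun ω _ =>
    mul_nonneg (Finset.prod_nonneg fun i _ => hw0 i _) (hf ω)]
  refine Finset.sum_congr rfl fun ω _ => ?_
  rw [indep_apply, ENNReal.ofReal_mul (Finset.prod_nonneg fun i _ => hw0 i _),
    ENNReal.ofReal_prod_of_nonneg fun i _ => hw0 i _]
  simp only [hw]

end Mean

/-! ### The protocol's random choices as real weights -/

lemma coin_apply {w : ℝ≥0} (hw : w ≤ 1) (b : Bool) :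
    coin w b = ENNReal.ofReal (coinWeight w b) := by
  have h : coin w b = if b then ((min w 1 : ℝ≥0) : ℝ≥0∞) else 1 - ((min w 1 : ℝ≥0) : ℝ≥0∞) := rfl
  rw [h, min_eq_left hw, coinWeight]
  split_ifs
  · simp
  · rw [ENNReal.ofReal_sub _ w.coe_nonneg]
    simp

lemma channelAndCoin_apply [NeZero F] {w : ℝ≥0} (hw : w ≤ 1) (r : Fin F × Bool) :
    channelAndCoin F w r = ENNReal.ofReal (choiceWeight F w r) := by
  classical
  obtain ⟨c, b⟩ := r
  have hF : (0 : ℝ) < F := Nat.cast_pos.2 (NeZero.pos F)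
  have h : ∀ d, ((coin w).map fun b => (d, b)) (c, b) = if d = c then coin w b else 0 := fun d => by
    rw [PMF.map_apply, tsum_fintype]
    by_cases hd : d = c
    · subst hd
      simp [Prod.ext_iff]
    · simp [Prod.ext_iff, hd, Ne.symm hd]
  have hc : choiceWeight F w (c, b) = coinWeight w b / F := rfl
  rw [channelAndCoin, PMF.bind_apply, tsum_fintype]
  simp only [h, PMF.uniformOfFintype_apply, mul_ite, mul_zero]
  rw [Finset.sum_ite_eq' Finset.univ c]
  rw [if_pos (Finset.mem_univ c), hc, ENNReal.ofReal_div_of_pos hF, coin_apply hw]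
  simp [div_eq_mul_inv, mul_comm]

end

section

variable {n F : ℕ}

/-- The potential of the primary-channel process. -/
noncomputable def primaryPotential (ζ : ℝ≥0) (x : Config n) : ℝ :=
  potential 1 0 (ζ / 600000 / 16) x.active fun v => (x.q v : ℝ)

lemma primaryPotential_nonneg {ζ : ℝ≥0} (x : Config n) : 0 ≤ primaryPotential ζ x :=
  potential_nonneg one_pos fun v _ => (x.q v).coe_nonneg

lemma primaryPotential_multi_le {ζ : ℝ≥0} {x : Config n} (hζ1 : ζ ≤ 1 / 2) (r : Fin n → Fin F × Bool) :
    primaryPotential ζ (afterMulti ζ x r) ≤ primaryPotential ζ x := by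
  have hζ1' : (ζ : ℝ) ≤ 1 / 2 := by exact_mod_cast hζ1
  exact potential_mono one_pos (by simp) (by positivity) (by linarith)
    (progress_afterMulti ζ x r).active_subset fun v _ => (x.q v).coe_nonneg

/-! ## The Markov chain -/

/-- The law of the configuration after `s` half-rounds, starting with the `h`-th half-round in the
configuration `x`. -/
noncomputable def run (F : ℕ) [NeZero F] (ζ : ℝ≥0) (h : ℕ) : ℕ → Config n → PMF (Config n)
  | 0, x => PMF.pure x
  | s + 1, x => (run F ζ h s x).bind (halfRound F ζ (h + s))

section Run

variable [NeZero F] {ζ : ℝ≥0}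

lemma run_add (h s t : ℕ) (x : Config n) :
    run F ζ h (s + t) x = (run F ζ h s x).bind (run F ζ (h + s) t) := by
  induction t with
  | zero => exact (PMF.bind_pure _).symm
  | succ t ih =>
    rw [← add_assoc, run, ih, PMF.bind_bind]
    simp only [run, add_assoc]

/-- Later half-rounds never overwrite entry `h`, so the marginals of the path law are those of the
Markov chain. -/
lemma execution_map (K : Finset (Fin n)) {h H : ℕ} (hH : h ≤ H) :
    (execution F ζ K H).map (fun x => x h) = run F ζ 0 h (init ζ K) := by
  induction H generalizing h with
  | zero =>
    obtain rfl := Nat.le_zero.1 hH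
    exact PMF.pure_map _ _
  | succ H ih =>
    rw [execution, PMF.map_bind]
    rcases hH.lt_or_eq with hlt | rfl
    · have : ∀ x : ℕ → Config n, ((halfRound F ζ H (x H)).map fun y =>
          Function.update x (H + 1) y).map (fun x => x h) = PMF.pure (x h) := fun x => by
        rw [PMF.map_comp]
        have : (fun x : ℕ → Config n => x h) ∘ (fun y => Function.update x (H + 1) y) =
            Function.const _ (x h) := by
          funext y
          simp [Function.update_of_ne hlt.ne]
        rw [this, PMF.map_const]
      simp only [this]
      rw [← ih (Nat.lt_succ_iff.1 hlt)]
      exact PMF.bind_pure_comp _ _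
    · have : ∀ x : ℕ → Config n, ((halfRound F ζ H (x H)).map fun y =>
          Function.update x (H + 1) y).map (fun x => x (H + 1)) = halfRound F ζ H (x H) :=
        fun x => by
          rw [PMF.map_comp]
          have : (fun x : ℕ → Config n => x (H + 1)) ∘ (fun y => Function.update x (H + 1) y) =
              id := by
            funext y
            simp
          rw [this, PMF.map_id]
      simp only [this]
      rw [run, ← ih le_rfl, PMF.bind_map, zero_add]
      rfl

lemma execution_path (K : Finset (Fin n)) {H : ℕ} {x : ℕ → Config n}
    (hx : x ∈ (execution F ζ K H).support) :
    x 0 = init ζ K ∧ ∀ h < H, Progress (x h) (x (h + 1)) := by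
  induction H generalizing x with
  | zero =>
    rw [execution, PMF.mem_support_pure_iff] at hx
    exact ⟨by rw [hx], fun h hh => absurd hh (Nat.not_lt_zero h)⟩
  | succ H ih =>
    rw [execution, PMF.mem_support_bind_iff] at hx
    obtain ⟨x', hx', hx⟩ := hx
    obtain ⟨y, hy, rfl⟩ := (PMF.mem_support_map_iff _ _ _).1 hx
    obtain ⟨h0, hstep⟩ := ih hx'
    refine ⟨by rw [Function.update_of_ne (by omega), h0], fun h hh => ?_⟩
    rw [Function.update_of_ne (by omega)]
    rcases (Nat.lt_succ_iff.1 hh).lt_or_eq with hlt | rfl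
    · rw [Function.update_of_ne (by omega)]
      exact hstep h hlt
    · rw [Function.update_self]
      exact progress_of_mem_support hy

/-! ### Bounds for the transmission probabilities -/

/-- All transmission probabilities are in the range of the protocol, and `ε` is a lower bound for
those on the primary channel. -/
structure Valid (ζ ε : ℝ≥0) (x : Config n) : Prop where
  p_pos : ∀ v, 0 < x.p v
  p_le : ∀ v, x.p v ≤ ζ
  le_q : ∀ v, ε ≤ x.q v
  q_le : ∀ v, x.q v ≤ ζ

variable {ε : ℝ≥0} {x y : Config n}

lemma newProb_le {w : ℝ≥0} (hw : w ≤ ζ) (o : Observation n) : newProb ζ w o ≤ ζ := by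
  cases o with
  | silence => exact min_le_left _ _
  | _ => exact (half_le_self zero_le).trans hw

lemma half_le_newProb {w : ℝ≥0} (hw : w ≤ ζ) (o : Observation n) : w / 2 ≤ newProb ζ w o := by
  cases o with
  | silence =>
    refine le_min ((half_le_self zero_le).trans hw) ((half_le_self zero_le).trans ?_)
    rw [two_mul]
    exact le_self_add
  | _ => exact le_rfl

/-- Halving `ε` in every half-round is generous, since `q` changes only in odd ones; the resulting
factor `2^(2s)` is affordable because its logarithm is linear in `s`. No such quantitative bound is
kept for `p`, as the multi-channel potential is bounded from above only at the start. -/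
lemma Valid.halfRound (hx : Valid ζ ε x) {h : ℕ} (hy : y ∈ (halfRound F ζ h x).support) :
    Valid ζ (ε / 2) y := by
  have hε : ∀ v, ε / 2 ≤ x.q v := fun v => (half_le_self zero_le).trans (hx.le_q v)
  unfold UIE.halfRound at hy
  split_ifs at hy
  · obtain ⟨r, -, rfl⟩ := (PMF.mem_support_map_iff _ _ _).1 hy
    refine ⟨fun v => ?_, fun v => ?_, hε, hx.q_le⟩
    · simp only [afterMulti]
      split_ifs
      · exact (half_pos (hx.p_pos v)).trans_le (half_le_newProb (hx.p_le v) _)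
      · exact hx.p_pos v
    · simp only [afterMulti]
      split_ifs
      · exact newProb_le (hx.p_le v) _
      · exact hx.p_le v
  · obtain ⟨b, -, rfl⟩ := (PMF.mem_support_map_iff _ _ _).1 hy
    refine ⟨hx.p_pos, hx.p_le, fun v => ?_, fun v => ?_⟩
    · simp only [afterPrimary]
      split_ifs
      · refine le_trans ?_ (half_le_newProb (hx.q_le v) _)
        gcongr
        exact hx.le_q v
      · exact hε v
    · simp only [afterPrimary]
      split_ifs
      · exact newProb_le (hx.q_le v) _
      · exact hx.q_le v

lemma Valid.run (hx : Valid ζ ε x) {h s : ℕ} (hy : y ∈ (run F ζ h s x).support) :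
    Valid ζ (ε / 2 ^ s) y := by
  induction s generalizing y with
  | zero =>
    rw [UIE.run, PMF.mem_support_pure_iff] at hy
    simpa [hy] using hx
  | succ s ih =>
    rw [UIE.run, PMF.mem_support_bind_iff] at hy
    obtain ⟨z, hz, hy⟩ := hy
    have := (ih hz).halfRound hy
    rwa [div_div, ← pow_succ] at this

lemma valid_init (hζ : 0 < ζ) (K : Finset (Fin n)) : Valid ζ ζ (init ζ K) :=
  ⟨fun _ => hζ, fun _ => le_rfl, fun _ => le_rfl, fun _ => le_rfl⟩

/-! ### Contraction of the potentials -/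

/-- The mean contraction of the potentials. -/
noncomputable def rate (ζ : ℝ≥0) : ℝ := Real.exp (-(ζ / 600000 / 64))

/-- The potential of the multi-channel process. -/
noncomputable def multiPotential (F : ℕ) (ζ : ℝ≥0) (x : Config n) : ℝ :=
  potential F (10 * F) (ζ / 600000 / 16) x.active fun v => (x.p v : ℝ)

lemma multiPotential_nonneg (x : Config n) : 0 ≤ multiPotential F ζ x :=
  potential_nonneg (Nat.cast_pos.2 (NeZero.pos F)) fun v _ => (x.p v).coe_nonneg

lemma multiPotential_primary_le (hζ1 : ζ ≤ 1 / 2) (b : Fin n → Bool) :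
    multiPotential F ζ (afterPrimary F ζ x b) ≤ multiPotential F ζ x := by
  have hζ1' : (ζ : ℝ) ≤ 1 / 2 := by exact_mod_cast hζ1
  have hF : (1 : ℝ) ≤ F := by exact_mod_cast NeZero.one_le
  exact potential_mono (by linarith) (by push_cast; linarith) (by positivity) (by linarith)
    (progress_afterPrimary ζ x b).active_subset fun v _ => (x.p v).coe_nonneg

lemma mean_multiStep_le (hζ : 0 < ζ) (hζ1 : ζ ≤ 1 / 2) (hx : Valid ζ ε x) :
    mean (multiStep F ζ x) (fun y => ENNReal.ofReal (multiPotential F ζ y)) ≤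
      ENNReal.ofReal (rate ζ) * ENNReal.ofReal (multiPotential F ζ x) := by
  have hp1 : ∀ v, x.p v ≤ 1 := fun v =>
    (hx.p_le v).trans (hζ1.trans (by rw [div_le_iff₀ two_pos]; norm_num))
  rw [← ENNReal.ofReal_mul (by exact (Real.exp_pos _).le : 0 ≤ rate ζ)]
  refine mean_indep_map_le (fun i a => channelAndCoin_apply (hp1 i) a) (fun i a => ?_)
    (fun r => multiPotential_nonneg _) (sum_potential_multi_le hζ hζ1 hx.p_pos hx.p_le)
  have h1 : (x.p i : ℝ) ≤ 1 := by exact_mod_cast hp1 i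
  unfold choiceWeight
  split_ifs
  · positivity
  · exact div_nonneg (by linarith) (Nat.cast_nonneg F)

lemma mean_primaryStep_le (hn : 2 ≤ n) (hζ : 0 < ζ) (hζ1 : ζ ≤ 1 / 2) (hε : 0 < ε)
    (hx : Valid ζ ε x) :
    mean (primaryStep F ζ x) (fun y => ENNReal.ofReal (primaryPotential ζ y)) ≤
      ENNReal.ofReal (rate ζ) * ENNReal.ofReal (primaryPotential ζ x) := by
  have hq1 : ∀ v, x.q v ≤ 1 := fun v =>
    (hx.q_le v).trans (hζ1.trans (by rw [div_le_iff₀ two_pos]; norm_num))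
  rw [← ENNReal.ofReal_mul (by exact (Real.exp_pos _).le : 0 ≤ rate ζ)]
  refine mean_indep_map_le (fun i a => coin_apply (hq1 i) a) (fun i a => ?_)
    (fun r => primaryPotential_nonneg _)
    (sum_potential_primary_le hn hζ hζ1 (fun v => hε.trans_le (hx.le_q v)) hx.q_le)
  have h1 : (x.q i : ℝ) ≤ 1 := by exact_mod_cast hq1 i
  unfold coinWeight
  split_ifs
  · positivity
  · linarith

lemma run_two {h : ℕ} (hh : Even h) (x : Config n) :
    run F ζ h 2 x = (multiStep F ζ x).bind (primaryStep F ζ) := by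
  have h1 : halfRound (n := n) F ζ h = multiStep F ζ := if_pos hh
  have h2 : halfRound (n := n) F ζ (h + 1) = primaryStep F ζ :=
    if_neg (by simpa [Nat.even_add_one] using hh)
  simp only [run, PMF.pure_bind, add_zero, h1, h2]

lemma mean_run_multi_le (hζ : 0 < ζ) (hζ1 : ζ ≤ 1 / 2) {h : ℕ} (hh : Even h) (hx : Valid ζ ε x) :
    mean (run F ζ h 2 x) (fun y => ENNReal.ofReal (multiPotential F ζ y)) ≤
      ENNReal.ofReal (rate ζ) * ENNReal.ofReal (multiPotential F ζ x) := by
  rw [run_two hh, mean_bind]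
  refine (mean_mono fun y _ => ?_).trans (mean_multiStep_le hζ hζ1 hx)
  rw [primaryStep, mean_map]
  exact (mean_mono fun b _ => ENNReal.ofReal_le_ofReal (multiPotential_primary_le hζ1 b)).trans
    (mean_const _ _).le

lemma mean_run_primary_le (hn : 2 ≤ n) (hζ : 0 < ζ) (hζ1 : ζ ≤ 1 / 2) (hε : 0 < ε) {h : ℕ}
    (hh : Even h) (hx : Valid ζ ε x) :
    mean (run F ζ h 2 x) (fun y => ENNReal.ofReal (primaryPotential ζ y)) ≤
      ENNReal.ofReal (rate ζ) * ENNReal.ofReal (primaryPotential ζ x) := by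
  rw [run_two hh, mean_bind]
  have h1 : ∀ y ∈ (multiStep F ζ x).support,
      mean (primaryStep F ζ y) (fun z => ENNReal.ofReal (primaryPotential ζ z)) ≤
        ENNReal.ofReal (rate ζ) * ENNReal.ofReal (primaryPotential ζ y) := fun y hy =>
    mean_primaryStep_le hn hζ hζ1 (half_pos hε) (hx.halfRound (h := 0) hy)
  refine (mean_mono h1).trans ?_
  rw [mean_const_mul]
  gcongr
  rw [multiStep, mean_map]
  exact (mean_mono fun b _ => ENNReal.ofReal_le_ofReal (primaryPotential_multi_le hζ1 b)).trans
    (mean_const _ _).le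

/-- A potential that contracts in every round decays exponentially. -/
lemma mean_run_le {V : Config n → ℝ≥0∞} {ρ : ℝ≥0∞} {h : ℕ} (hh : Even h) (hε : 0 < ε)
    (hV : ∀ h, Even h → ∀ ε > 0, ∀ x, Valid ζ ε x → mean (run F ζ h 2 x) V ≤ ρ * V x)
    (hx : Valid ζ ε x) (t : ℕ) : mean (run F ζ h (2 * t) x) V ≤ ρ ^ t * V x := by
  induction t with
  | zero => simp [run, mean_pure]
  | succ t ih =>
    rw [mul_add, mul_one, run_add, mean_bind]
    calc _ ≤ mean (run F ζ h (2 * t) x) fun y => ρ * V y := mean_mono fun y hy =>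
          hV _ (hh.add (even_two_mul t)) _ (by positivity) y (hx.run hy)
      _ ≤ ρ * (ρ ^ t * V x) := by rw [mean_const_mul]; gcongr
      _ = _ := by rw [pow_succ, mul_left_comm, mul_assoc, mul_left_comm]

/-- The probability that some node is still active after `s + t` rounds. -/
lemma mean_active_le (hn : 2 ≤ n) (hζ : 0 < ζ) (hζ1 : ζ ≤ 1 / 2) (K : Finset (Fin n)) (s t : ℕ) :
    mean (run F ζ 0 (2 * s + 2 * t) (init ζ K))
        (Set.indicator {x : Config n | x.active ≠ ∅} 1) ≤
      ENNReal.ofReal (rate ζ ^ s * (Real.exp (6 * K.card / F) / ζ) +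
        rate ζ ^ t * (Real.exp (60 * F) / (ζ / 2 ^ (2 * s)))) := by
  have hζ' : (0 : ℝ) < ζ := by exact_mod_cast hζ
  have hζ1' : (ζ : ℝ) ≤ 1 / 2 := by exact_mod_cast hζ1
  have hF : (1 : ℝ) ≤ F := by exact_mod_cast NeZero.one_le
  have hr : 0 < rate ζ := Real.exp_pos _
  have hvalid := valid_init (n := n) hζ K
  set B : Config n → ℝ≥0∞ := Set.indicator {x : Config n | x.active ≠ ∅} 1 with hB
  have hB1 : ∀ x, B x ≤ 1 := fun x => by
    by_cases h : x ∈ {x : Config n | x.active ≠ ∅} <;> simp [hB, h]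
  rw [run_add, mean_bind, zero_add]
  have hinner : ∀ y ∈ (run F ζ 0 (2 * s) (init ζ K)).support,
      mean (run F ζ (2 * s) (2 * t) y) B ≤ ENNReal.ofReal (multiPotential F ζ y) +
        ENNReal.ofReal (rate ζ ^ t * (Real.exp (60 * F) / (ζ / 2 ^ (2 * s)))) := by
    intro y hy
    have hyv := hvalid.run hy
    -- If the first phase succeeded, the primary process starts with at most `10F` nodes, whence
    -- `exp (60F)`. Otherwise the multi-channel potential is still at least `1` and pays for the
    -- failure.
    by_cases hcard : y.active.card ≤ 10 * F
    · refine le_trans ?_ le_add_self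
      have hε : 0 < ζ / 2 ^ (2 * s) := by positivity
      calc mean (run F ζ (2 * s) (2 * t) y) B
          ≤ mean (run F ζ (2 * s) (2 * t) y) fun z => ENNReal.ofReal (primaryPotential ζ z) := by
            refine mean_mono fun z hz => ?_
            by_cases h : z.active = ∅
            · simp [hB, h]
            · refine (hB1 z).trans (ENNReal.one_le_ofReal.2 ?_)
              refine one_le_potential one_pos (by positivity)
                (Finset.card_pos.2 (Finset.nonempty_iff_ne_empty.2 h)) fun v _ => ?_
              have : 0 < z.q v := lt_of_lt_of_le (by positivity) ((hyv.run hz).le_q v)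
              exact_mod_cast this
        _ ≤ ENNReal.ofReal (rate ζ) ^ t * ENNReal.ofReal (primaryPotential ζ y) :=
            mean_run_le (even_two_mul s) hε
              (fun h hh ε hε x hx => mean_run_primary_le hn hζ hζ1 hε hh hx) hyv t
        _ ≤ _ := by
            rw [← ENNReal.ofReal_pow hr.le, ← ENNReal.ofReal_mul (by positivity)]
            refine ENNReal.ofReal_le_ofReal (mul_le_mul_of_nonneg_left ?_ (by positivity))
            have hq : ∀ v, (ζ : ℝ) / 2 ^ (2 * s) ≤ y.q v := fun v => by
              exact_mod_cast hyv.le_q v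
            refine (potential_le le_rfl (by positivity) (by linarith) (by positivity) ?_
              (fun v _ => hq v) (fun v _ => ?_) (by simp)).trans ?_
            · exact (div_le_self hζ'.le (one_le_pow₀ one_le_two)).trans (by linarith)
            · have : (y.q v : ℝ) ≤ ζ := by exact_mod_cast hyv.q_le v
              linarith
            · have hc : (y.active.card : ℝ) ≤ 10 * F := by exact_mod_cast hcard
              gcongr
              linarith
    · refine le_trans ?_ le_self_add
      calc mean (run F ζ (2 * s) (2 * t) y) B ≤ mean (run F ζ (2 * s) (2 * t) y) fun _ => 1 :=
            mean_mono fun z _ => hB1 z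
        _ = 1 := mean_const _ _
        _ ≤ _ := ENNReal.one_le_ofReal.2 (one_le_potential (by linarith) (by positivity)
            (not_le.1 hcard) fun v _ => by exact_mod_cast hyv.p_pos v)
  refine (mean_mono hinner).trans ?_
  rw [mean_add, mean_const, ENNReal.ofReal_add (by positivity) (by positivity)]
  gcongr
  refine (mean_run_le Even.zero hζ
    (fun h hh ε _ x hx => mean_run_multi_le hζ hζ1 hh hx) hvalid s).trans ?_
  rw [← ENNReal.ofReal_pow hr.le, ← ENNReal.ofReal_mul (by positivity)]
  refine ENNReal.ofReal_le_ofReal (mul_le_mul_of_nonneg_left ?_ (by positivity))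
  exact potential_le hF (by positivity) (by linarith) hζ' (by linarith) (fun v _ => le_rfl)
    (fun v _ => by simp only [init]; linarith) (by push_cast; linarith)

end Run

/-! ## Time bounds -/

/-- Within time `ν (k / F + F log n)` both phases can be made long enough. -/
lemma exists_phases {ζ : ℝ≥0} (hζ : 0 < ζ) (hζ1 : ζ ≤ 1 / 2) :
    ∃ ν : ℝ, 0 < ν ∧ ∀ n F k : ℕ, 2 ≤ n → 1 ≤ F → ∃ s t : ℕ,
      ((s + t : ℕ) : ℝ) ≤ tStar ν n F k ∧
      rate ζ ^ s * (Real.exp (6 * k / F) / ζ) +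
        rate ζ ^ t * (Real.exp (60 * F) / (ζ / 2 ^ (2 * s))) ≤ 1 / n := by
  have hζ' : (0 : ℝ) < ζ := by exact_mod_cast hζ
  have hζ1' : (ζ : ℝ) ≤ 1 / 2 := by exact_mod_cast hζ1
  set η : ℝ := ζ / 600000 / 64 with hη
  have hη0 : 0 < η := by positivity
  -- Since `L ≥ 1/2`, `c * L` absorbs `log 2 - log ζ`.
  set c : ℝ := 2 * (1 - Real.log ζ) with hc
  have hlogζ : Real.log ζ ≤ 0 := Real.log_nonpos hζ'.le (by linarith)
  have hc0 : 0 ≤ c := by linarith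
  -- In `α`, `7` is `6` for `k / F` plus `1` for `log n`. In `γ`, `125` is `120` for `60 F ≤ 120 L`,
  -- `4` for rounding in `2 s ≤ 2 α L + 2`, and `1` for `log n`.
  set α : ℝ := (7 + c) / η with hα
  set γ : ℝ := (125 + 2 * α + c) / η with hγ
  have hα0 : 0 < α := by positivity
  have hγ0 : 0 < γ := by positivity
  -- The `4` pays for rounding up twice, as `2 ≤ 4 L`.
  refine ⟨α + γ + 4, by positivity, fun n F k hn hF => ?_⟩
  have hF1 : (1 : ℝ) ≤ F := by exact_mod_cast hF
  have hn0 : (0 : ℝ) < n := by exact_mod_cast (by omega : 0 < n)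
  have hlog2 : 1 / 2 ≤ Real.log 2 := by linarith [Real.log_two_gt_d9]
  have hlog2' : Real.log 2 ≤ 1 := by linarith [Real.log_two_lt_d9]
  have hlogn : 1 / 2 ≤ Real.log n :=
    hlog2.trans (Real.log_le_log two_pos (by exact_mod_cast hn))
  set L : ℝ := (k : ℝ) / F + F * Real.log n with hL
  have hkF : 0 ≤ (k : ℝ) / F := by positivity
  have hL1 : F ≤ 2 * L := by nlinarith
  have hL2 : Real.log n ≤ L := by nlinarith
  have hL3 : (k : ℝ) / F ≤ L := by nlinarith
  have hcL : Real.log 2 - Real.log ζ ≤ c * L := by nlinarith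
  have hs1 : α * L ≤ ⌈α * L⌉₊ := Nat.le_ceil _
  have hs2 : (⌈α * L⌉₊ : ℝ) ≤ α * L + 1 := (Nat.ceil_lt_add_one (by nlinarith)).le
  have ht1 : γ * L ≤ ⌈γ * L⌉₊ := Nat.le_ceil _
  have ht2 : (⌈γ * L⌉₊ : ℝ) ≤ γ * L + 1 := (Nat.ceil_lt_add_one (by nlinarith)).le
  set s : ℕ := ⌈α * L⌉₊
  set t : ℕ := ⌈γ * L⌉₊
  refine ⟨s, t, ?_, ?_⟩
  · rw [tStar, ← hL]
    push_cast
    linarith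
  have hrate : ∀ m : ℕ, rate ζ ^ m = Real.exp (-(η * m)) := fun m => by
    rw [rate, ← Real.exp_nat_mul, ← hη]
    congr 1
    ring
  have hzeta : (ζ : ℝ) = Real.exp (Real.log ζ) := (Real.exp_log hζ').symm
  have hhalf : Real.exp (-Real.log n - Real.log 2) = 1 / n / 2 := by
    rw [Real.exp_sub, Real.exp_neg, Real.exp_log hn0, Real.exp_log two_pos, one_div]
  have e1 : rate ζ ^ s * (Real.exp (6 * k / F) / ζ) ≤ 1 / n / 2 := by
    rw [← hhalf, hrate]
    conv_lhs => rw [hzeta]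
    rw [← Real.exp_sub, ← Real.exp_add]
    apply Real.exp_le_exp.2
    have h1 : (7 + c) * L ≤ η * s := by
      calc (7 + c) * L = η * (α * L) := by rw [hα]; field_simp
        _ ≤ _ := by gcongr
    have h2 : 6 * (k : ℝ) / F = 6 * (k / F) := by ring
    rw [h2]
    linarith
  have e2 : rate ζ ^ t * (Real.exp (60 * F) / (ζ / 2 ^ (2 * s))) ≤ 1 / n / 2 := by
    have hpow : (2 : ℝ) ^ (2 * s) ≤ Real.exp (2 * s) := by
      calc (2 : ℝ) ^ (2 * s) ≤ Real.exp 1 ^ (2 * s) := by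
            gcongr
            linarith [Real.add_one_le_exp (1 : ℝ)]
        _ = _ := by rw [← Real.exp_nat_mul]; push_cast; ring_nf
    rw [div_div_eq_mul_div]
    calc rate ζ ^ t * (Real.exp (60 * F) * 2 ^ (2 * s) / ζ) ≤
          rate ζ ^ t * (Real.exp (60 * F) * Real.exp (2 * s) / ζ) := by
          have : 0 < rate ζ := Real.exp_pos _
          gcongr
      _ ≤ _ := by
          rw [← hhalf, hrate]
          conv_lhs => rw [hzeta]
          rw [← Real.exp_add, ← Real.exp_sub, ← Real.exp_add]
          apply Real.exp_le_exp.2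
          have h1 : (125 + 2 * α + c) * L ≤ η * t := by
            calc (125 + 2 * α + c) * L = η * (γ * L) := by rw [hγ]; field_simp
              _ ≤ _ := by gcongr
          linarith
  linarith

end

end UIE

/-! ### The theorem -/

theorem theorem2 :
    ∃ ζ₀ : ℝ≥0, 0 < ζ₀ ∧ ζ₀ < 1 ∧ ∀ ζ : ℝ≥0, 0 < ζ → ζ ≤ ζ₀ →
      ∃ ν c : ℝ, 0 < ν ∧ 0 < c ∧
        ∀ (n F : ℕ) [NeZero F] (K : Finset (Fin n)), 1 ≤ K.card →
          -- by time `T*` only one active node is left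
          (1 - 1 / (n : ℝ) ^ c ≤
            UIE.prob (UIE.execution F ζ K (2 * UIE.lastRound ν n F K.card))
              {x | ∃ v, UIE.SoleActiveBy x (UIE.tStar ν n F K.card) v}) ∧
          -- moreover, at time `2 T* + log n` this node is inactive and everybody knows all packets
          (1 - 1 / (n : ℝ) ^ c ≤
            UIE.prob (UIE.execution F ζ K (2 * UIE.lastRound ν n F K.card))
              {x | ∃ v, UIE.SoleActiveBy x (UIE.tStar ν n F K.card) v ∧
                v ∉ (x (2 * UIE.lastRound ν n F K.card)).active ∧
                ∀ u, K ⊆ (x (2 * UIE.lastRound ν n F K.card)).known u}) := by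
  -- The bound `1/2` is what `exp (-2x) ≤ 1 - x` requires of the probabilities.
  refine ⟨1 / 2, by norm_num, ?_, fun ζ hζ hζ1 => ?_⟩
  · rw [div_lt_iff₀ two_pos]
    norm_num
  obtain ⟨ν, hν, hphases⟩ := UIE.exists_phases hζ hζ1
  refine ⟨ν, 1, hν, one_pos, fun n F _ K hK => ?_⟩
  have hn1 : 1 ≤ n := hK.trans (by simpa using Finset.card_le_univ K)
  -- For `n = 1` there is no other node to acknowledge, but the claimed lower bound is `0`.
  rcases hn1.eq_or_lt with rfl | hn
  · simp [UIE.prob]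
  rw [Real.rpow_one]
  obtain ⟨s, t, hT, hfail⟩ := hphases n F K.card hn NeZero.one_le
  set T := UIE.tStar ν n F K.card with hTdef
  -- Both phases already end by `T*`, so the horizon `2 T* + log n` leaves ample room.
  have hst : s + t ≤ UIE.lastRound ν n F K.card := by
    refine Nat.le_floor ?_
    have h0 : (0 : ℝ) ≤ (s + t : ℕ) := Nat.cast_nonneg _
    have h1 : 0 ≤ Real.log n := Real.log_natCast_nonneg n
    linarith
  set H := 2 * UIE.lastRound ν n F K.card
  have hle : 2 * s + 2 * t ≤ H := by omega
  have hbad : UIE.mean (UIE.execution F ζ K H)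
      (Set.indicator {x | (x (2 * s + 2 * t)).active ≠ ∅} 1) ≤ ENNReal.ofReal (1 / n) := by
    refine le_trans (le_of_eq ?_) ((UIE.mean_active_le hn hζ hζ1 K s t).trans
      (ENNReal.ofReal_le_ofReal hfail))
    rw [← UIE.execution_map K hle, UIE.mean_map]
    rfl
  have hgood : ∀ x ∈ (UIE.execution F ζ K H).support,
      x ∉ {x : ℕ → UIE.Config n | (x (2 * s + 2 * t)).active ≠ ∅} →
        ∃ v, UIE.SoleActiveBy x T v ∧ v ∉ (x H).active ∧ ∀ u, K ⊆ (x H).known u := by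
    intro x hx hxs
    obtain ⟨h0, hstep⟩ := UIE.execution_path K hx
    obtain ⟨v, ⟨h, hh, hv⟩, hvH, hall⟩ := UIE.exists_sole_of_path (Finset.card_pos.1 hK) h0 hle
      hstep (by simpa using hxs)
    refine ⟨v, ⟨h, ?_, hv⟩, hvH, hall⟩
    have : (h : ℝ) ≤ 2 * (s + t : ℕ) := by
      exact_mod_cast (by omega : h ≤ 2 * (s + t))
    linarith
  have hn0 : (0 : ℝ) ≤ 1 / n := by positivity
  exact ⟨UIE.one_sub_le_prob (fun x hx hxs => (hgood x hx hxs).imp fun v hv => hv.1) hn0 hbad,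
    UIE.one_sub_le_prob hgood hn0 hbad⟩
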